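/- Let $G$ be an abelian group (written multiplicatively, with unit $e$). Algebras are not assumed associative or unital. A $G$-graded algebra is graded simple if its product is not identically zero and it has no homogeneous two-sided ideals other than $0$ and itself. For an $\mathbb F$-algebra $A$, the multiplication algebra $M(A)$ is the subalgebra of $\operatorname{End}_{\mathbb F}A$ generated by all left and right multiplications by elements of $A$ (no identity is adjoined). If $A$ is $G$-graded, $\Gamma(A)_e$ denotes the algebra of all endomorphisms of the $M(A)$-module $A$ that map each component $A_g$ into itself (the neutral component of the graded centroid), and $Z(M(A))_e$ denotes the set of elements of the center of $M(A)$ that map each $A_g$ into itself. Let $\mathcal U=\bigoplus_{g\in G}\mathcal U_g$ be a $G$-graded, graded simple algebra which is finite-dimensional over the field $\mathbb F=\Gamma(\mathcal U)_e$, and for each $g$ let $\{u^g_1,\dots,u^g_{n_g}\}$ be an $\mathbb F$-basis of $\mathcal U_g$. Let $\widetilde{\mathbb F}$ be an extension field of the field of fractions of the polynomial ring $\mathbb F[t^g_{ij} : g\in G,\ 1\le i,j\le n_g]$. Let $\widetilde{\mathcal U}=\widetilde{\mathbb F}\otimes_{\mathbb F}\mathcal U$, graded by $\widetilde{\mathcal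 U}_g=\widetilde{\mathbb F}\otimes_{\mathbb F}\mathcal U_g$, and let $\mathcal F_{\mathcal U}$ be the $\mathbb F$-subalgebra of $\widetilde{\mathcal U}$ generated by the generic elements $y^g_i=\sum_{j=1}^{n_g}t^g_{ij}\otimes u^g_j$, with the induced grading. Put $Z_{\mathcal U}=Z(M(\mathcal F_{\mathcal U}))_e$ and $S=Z_{\mathcal U}\setminus\{0\}$, and let $S^{-1}\mathcal F_{\mathcal U}$ be the localization, with product $(a/s)(b/t)=ab/(st)$ and with component of degree $g$ consisting of the fractions $a/s$ with $a\in(\mathcal F_{\mathcal U})_g$. Then: (i) There is an injective homomorphism of $\mathbb F$-algebras $\iota: Z_{\mathcal U}\to\widetilde{\mathbb F}$ such that $z(y)=\iota(z)\,y$ in $\widetilde{\mathcal U}$ for all $z\in Z_{\mathcal U}$, $y\in\mathcal F_{\mathcal U}$. (ii) $S^{-1}\mathcal F_{\mathcal U}$ is a graded simple algebra, and $M(S^{-1}\mathcal F_{\mathcal U})$ satisfies an ordinary polynomial identity, i.e. some nonzero polynomial in the free associative algebra over $\mathbb F$ in countably many variables vanishes on it. (iii) $K_{\mathcal U}=\Gamma(S^{-1}\mathcal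 F_{\mathcal U})_e$ is a field, and it is the field of fractions of $Z_{\mathcal U}$: the map $\tau:Z_{\mathcal U}\to K_{\mathcal U}$, $\tau(z)(a/s)=z(a)/s$, is an injective homomorphism of $\mathbb F$-algebras, and every element of $K_{\mathcal U}$ has the form $\tau(s)^{-1}\tau(z)$ with $z\in Z_{\mathcal U}$, $s\in S$. (iv) There are an $\mathbb F$-algebra homomorphism $\kappa:K_{\mathcal U}\to\widetilde{\mathbb F}$ with $\kappa\circ\tau=\iota$ and an $\mathbb F$-linear map $j:S^{-1}\mathcal F_{\mathcal U}\to\widetilde{\mathcal U}$ with $j(a/s)=\iota(s)^{-1}a$ for $a\in\mathcal F_{\mathcal U}$, $s\in S$; and, regarding $\widetilde{\mathbb F}$ as an extension of $K_{\mathcal U}$ through $\kappa$, the map $$\widetilde{\mathbb F}\otimes_{K_{\mathcal U}}S^{-1}\mathcal F_{\mathcal U}\to\widetilde{\mathcal U},\qquad \lambda\otimes x\mapsto\lambda\,j(x),$$ is a well-defined isomorphism of $G$-graded $\widetilde{\mathbb F}$-algebras. -/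

import Mathlib

open scoped TensorProduct IsMulCommutative

noncomputable section

/-! ### Localization of a (nonassociative, nonunital) algebra at a set of scalars -/

section AlgLocalization

/-- The localization `S⁻¹A` of a not necessarily associative or unital algebra `A` over a
commutative ring `R` at a submonoid `S` of `R`. As a module it is the usual localization; the
product is `(a / s) * (b / t) = (a * b) / (s * t)`. -/
def AlgLocalization {R : Type*} [CommRing R] (S : Submonoid R) (A : Type*)
    [NonUnitalNonAssocRing A] [Module R A] : Type _ :=
  LocalizedModule S A

namespace AlgLocalization

variable {R : Type*} [CommRing R] {S : Submonoid R} {A : Type*}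
  [NonUnitalNonAssocRing A] [Module R A]

instance : AddCommGroup (AlgLocalization S A) :=
  inferInstanceAs (AddCommGroup (LocalizedModule S A))

instance {k : Type*} [CommRing k] [Algebra k R] [Module k A] [IsScalarTower k R A] :
    Module k (AlgLocalization S A) :=
  inferInstanceAs (Module k (LocalizedModule S A))

/-- The fraction `a / s`. -/
def mk (a : A) (s : S) : AlgLocalization S A := LocalizedModule.mk a s

theorem mk_eq {a b : A} {s t : S} : mk a s = mk b t ↔ ∃ u : S, u • t • a = u • s • b :=
  LocalizedModule.mk_eq

theorem ind {p : AlgLocalization S A → Prop} (h : ∀ a s, p (mk a s)) (x) : p x :=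
  LocalizedModule.induction_on h x

theorem mk_add_mk (a b : A) (s t : S) : mk a s + mk b t = mk (t • a + s • b) (s * t) :=
  LocalizedModule.mk_add_mk

theorem smul_mk {k : Type*} [CommRing k] [Algebra k R] [Module k A] [IsScalarTower k R A]
    (c : k) (a : A) (s : S) : c • mk a s = mk (c • a) s :=
  LocalizedModule.smul'_mk c a s

theorem zero_mk (s : S) : mk (0 : A) s = 0 := LocalizedModule.zero_mk s

variable [IsScalarTower R A A] [SMulCommClass R A A]

instance : Mul (AlgLocalization S A) where
  mul x y := LocalizedModule.liftOn₂ x y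
    (fun p q => LocalizedModule.mk (p.1 * q.1) (p.2 * q.2)) (by
      rintro ⟨a₁, s₁⟩ ⟨a₂, s₂⟩ ⟨b₁, t₁⟩ ⟨b₂, t₂⟩ ⟨u₁, e₁⟩ ⟨u₂, e₂⟩
      refine LocalizedModule.mk_eq.2 ⟨u₁ * u₂, ?_⟩
      dsimp [Submonoid.smul_def] at *
      simp only [mul_smul_mul_comm, e₁, e₂])

theorem mk_mul_mk (a b : A) (s t : S) : mk a s * mk b t = mk (a * b) (s * t) :=
  LocalizedModule.liftOn₂_mk _ _ _ _ _ _

instance : NonUnitalNonAssocRing (AlgLocalization S A) where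
  left_distrib x y z := by
    induction x using ind with | _ a s
    induction y using ind with | _ b t
    induction z using ind with | _ c u
    simp only [mk_add_mk, mk_mul_mk]
    refine mk_eq.2 ⟨1, ?_⟩
    simp only [Submonoid.smul_def, Submonoid.coe_mul, mul_add, smul_add, mul_smul_comm, smul_smul]
    congr 2 <;> ring_nf
  right_distrib x y z := by
    induction x using ind with | _ a s
    induction y using ind with | _ b t
    induction z using ind with | _ c u
    simp only [mk_add_mk, mk_mul_mk]
    refine mk_eq.2 ⟨1, ?_⟩
    simp only [Submonoid.smul_def, Submonoid.coe_mul, add_mul, smul_add, smul_mul_assoc, smul_smul]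
    congr 2 <;> ring_nf
  zero_mul x := by
    induction x using ind with | _ a s
    rw [← zero_mk (1 : S), mk_mul_mk, zero_mul, zero_mk, zero_mk]
  mul_zero x := by
    induction x using ind with | _ a s
    rw [← zero_mk (1 : S), mk_mul_mk, mul_zero, zero_mk, zero_mk]

instance {k : Type*} [CommRing k] [Algebra k R] [Module k A] [IsScalarTower k R A]
    [IsScalarTower k A A] : IsScalarTower k (AlgLocalization S A) (AlgLocalization S A) where
  smul_assoc c x y := by
    induction x using ind with | _ a s
    induction y using ind with | _ b t
    simp only [smul_eq_mul, smul_mk, mk_mul_mk, smul_mul_assoc]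

instance {k : Type*} [CommRing k] [Algebra k R] [Module k A] [IsScalarTower k R A]
    [SMulCommClass k A A] : SMulCommClass k (AlgLocalization S A) (AlgLocalization S A) where
  smul_comm c x y := by
    induction x using ind with | _ a s
    induction y using ind with | _ b t
    simp only [smul_eq_mul, smul_mk, mk_mul_mk, mul_smul_comm]

end AlgLocalization

end AlgLocalization

/-! ### Graded algebras, multiplication algebras and centroids -/

section Graded

variable {F G A : Type*} [Field F] [NonUnitalNonAssocRing A] [Module F A]

/-- `𝒜` is a `G`-grading of the `F`-algebra `A`: `A = ⨁ 𝒜 g` and `𝒜 g * 𝒜 h ⊆ 𝒜 (g * h)`. -/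
structure IsAlgGrading [CommGroup G] (𝒜 : G → Submodule F A) : Prop where
  independent : iSupIndep 𝒜
  iSup_eq_top : ⨆ g, 𝒜 g = ⊤
  mul_mem : ∀ {g h : G} {x y : A}, x ∈ 𝒜 g → y ∈ 𝒜 h → x * y ∈ 𝒜 (g * h)

/-- A subspace is homogeneous if it is the sum of its intersections with the components. -/
def IsHomogeneousSubspace (𝒜 : G → Submodule F A) (V : Submodule F A) : Prop :=
  V = ⨆ g, V ⊓ 𝒜 g

/-- `A`, graded by `𝒜`, is graded simple: `A² ≠ 0` and the only homogeneous two-sided ideals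
are `0` and `A`. -/
structure IsGradedSimple [CommGroup G] (𝒜 : G → Submodule F A) : Prop where
  grading : IsAlgGrading 𝒜
  mul_ne_zero : ∃ x y : A, x * y ≠ 0
  eq_bot_or_eq_top : ∀ I : Submodule F A, (∀ x ∈ I, ∀ a : A, a * x ∈ I ∧ x * a ∈ I) →
    IsHomogeneousSubspace 𝒜 I → I = ⊥ ∨ I = ⊤

/-- An associative (possibly nonunital) algebra `M` of linear operators satisfies an ordinary
polynomial identity: some nonzero noncommutative polynomial vanishes under all substitutions of
elements of `M` for the variables. -/
def SatisfiesPI (M : NonUnitalSubalgebra F (Module.End F A)) : Prop :=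
  ∃ f : FreeAlgebra F ℕ, f ≠ 0 ∧
    ∀ m : ℕ → Module.End F A, (∀ i, m i ∈ M) → FreeAlgebra.lift F m f = 0

/-- A linear map of neutral degree. -/
def IsNeutralMap (𝒜 : G → Submodule F A) (φ : Module.End F A) : Prop :=
  ∀ g, ∀ x ∈ 𝒜 g, φ x ∈ 𝒜 g

variable [IsScalarTower F A A] [SMulCommClass F A A]

variable (F A) in
/-- The multiplication algebra `M(A)`: the subalgebra of `End_F A` generated by all left and
right multiplications. (Algebras are not assumed unital, and no identity is adjoined.) -/
def mulAlgebra : NonUnitalSubalgebra F (Module.End F A) :=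
  NonUnitalAlgebra.adjoin F
    (Set.range (LinearMap.mulLeft F : A → _) ∪ Set.range (LinearMap.mulRight F : A → _))

/-- `Z(M(A))_e`: the neutral component of the centre of the multiplication algebra. -/
def neutralCenter (𝒜 : G → Submodule F A) : NonUnitalSubalgebra F (Module.End F A) where
  carrier := {z | z ∈ mulAlgebra F A ∧ (∀ m ∈ mulAlgebra F A, z * m = m * z) ∧ IsNeutralMap 𝒜 z}
  zero_mem' := ⟨zero_mem _, fun m _ => by simp, fun g x _ => by simp⟩
  add_mem' := fun ⟨h1, h2, h3⟩ ⟨k1, k2, k3⟩ => ⟨add_mem h1 k1,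
    fun m hm => by rw [add_mul, mul_add, h2 m hm, k2 m hm],
    fun g x hx => add_mem (h3 g x hx) (k3 g x hx)⟩
  mul_mem' := fun {a b} ⟨h1, h2, h3⟩ ⟨k1, k2, k3⟩ => ⟨mul_mem h1 k1,
    fun m hm => by rw [mul_assoc, k2 m hm, ← mul_assoc, h2 m hm, mul_assoc],
    fun g x hx => h3 g _ (k3 g x hx)⟩
  smul_mem' := fun c a ⟨h1, h2, h3⟩ => ⟨SMulMemClass.smul_mem c h1,
    fun m hm => by rw [smul_mul_assoc, mul_smul_comm, h2 m hm],
    fun g x hx => (𝒜 g).smul_mem c (h3 g x hx)⟩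

/-- `Γ(A)_e`: the neutral component of the graded centroid, i.e. the endomorphisms of the
`M(A)`-module `A` that have neutral degree. -/
def neutralCentroid (𝒜 : G → Submodule F A) : Subalgebra F (Module.End F A) where
  carrier := {φ | (∀ m ∈ mulAlgebra F A, φ * m = m * φ) ∧ IsNeutralMap 𝒜 φ}
  add_mem' := fun ⟨h2, h3⟩ ⟨k2, k3⟩ =>
    ⟨fun m hm => by rw [add_mul, mul_add, h2 m hm, k2 m hm],
    fun g x hx => add_mem (h3 g x hx) (k3 g x hx)⟩
  mul_mem' := fun {a b} ⟨h2, h3⟩ ⟨k2, k3⟩ =>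
    ⟨fun m hm => by rw [mul_assoc, k2 m hm, ← mul_assoc, h2 m hm, mul_assoc],
    fun g x hx => h3 g _ (k3 g x hx)⟩
  algebraMap_mem' := fun c => ⟨fun m _ => Algebra.commutes c m,
    fun g x hx => (𝒜 g).smul_mem c hx⟩

theorem mulLeft_mem_mulAlgebra (a : A) : LinearMap.mulLeft F a ∈ mulAlgebra F A :=
  NonUnitalAlgebra.subset_adjoin F (Or.inl ⟨a, rfl⟩)

theorem mulRight_mem_mulAlgebra (a : A) : LinearMap.mulRight F a ∈ mulAlgebra F A :=
  NonUnitalAlgebra.subset_adjoin F (Or.inr ⟨a, rfl⟩)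

theorem neutralCentroid_mul_left {𝒜 : G → Submodule F A} {φ : Module.End F A}
    (h : φ ∈ neutralCentroid 𝒜) (x y : A) : φ (x * y) = x * φ y :=
  LinearMap.congr_fun (h.1 _ (mulLeft_mem_mulAlgebra x)) y

theorem neutralCentroid_mul_right {𝒜 : G → Submodule F A} {φ : Module.End F A}
    (h : φ ∈ neutralCentroid 𝒜) (x y : A) : φ (x * y) = φ x * y :=
  LinearMap.congr_fun (h.1 _ (mulRight_mem_mulAlgebra y)) x

theorem neutralCenter_le_neutralCentroid {𝒜 : G → Submodule F A} {φ : Module.End F A}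
    (h : φ ∈ neutralCenter 𝒜) : φ ∈ neutralCentroid 𝒜 := ⟨h.2.1, h.2.2⟩

instance (𝒜 : G → Submodule F A) : IsScalarTower (neutralCentroid 𝒜) A A where
  smul_assoc c x y := (neutralCentroid_mul_right c.2 x y).symm

instance (𝒜 : G → Submodule F A) : SMulCommClass (neutralCentroid 𝒜) A A where
  smul_comm c x y := neutralCentroid_mul_left c.2 x y

/-! ### The central localization -/

/-- The commutative ring of scalars `F + Z(M(A))_e`, acting on `A`. -/
def centralScalars (𝒜 : G → Submodule F A) : Subalgebra F (Module.End F A) :=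
  Algebra.adjoin F (neutralCenter 𝒜 : Set (Module.End F A))

instance (𝒜 : G → Submodule F A) : IsMulCommutative (centralScalars 𝒜) :=
  Algebra.isMulCommutative_adjoin F fun _ ha _ hb => ha.2.1 _ hb.1

theorem centralScalars_le_neutralCentroid (𝒜 : G → Submodule F A) :
    centralScalars 𝒜 ≤ neutralCentroid 𝒜 :=
  Algebra.adjoin_le fun _ h => neutralCenter_le_neutralCentroid h

instance (𝒜 : G → Submodule F A) : IsScalarTower (centralScalars 𝒜) A A where
  smul_assoc c x y :=
    (neutralCentroid_mul_right (centralScalars_le_neutralCentroid 𝒜 c.2) x y).symm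

instance (𝒜 : G → Submodule F A) : SMulCommClass (centralScalars 𝒜) A A where
  smul_comm c x y := neutralCentroid_mul_left (centralScalars_le_neutralCentroid 𝒜 c.2) x y

/-- The multiplicative monoid generated by `Z(M(A))_e \ {0}`. -/
def denominators (𝒜 : G → Submodule F A) : Submonoid (centralScalars 𝒜) :=
  Submonoid.closure {s | (s : Module.End F A) ∈ neutralCenter 𝒜 ∧ s ≠ 0}

/-- The central localization `S⁻¹A` for `S = Z(M(A))_e \ {0}`. -/
abbrev CentralLocalization (𝒜 : G → Submodule F A) : Type _ :=
  AlgLocalization (R := centralScalars 𝒜) (denominators 𝒜) A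

/-- The fraction `a / s` with `s ∈ Z(M(A))_e \ {0}`. -/
def centralFrac (𝒜 : G → Submodule F A) (a : A) (s : neutralCenter 𝒜) (hs : s ≠ 0) :
    CentralLocalization 𝒜 :=
  AlgLocalization.mk (R := centralScalars 𝒜) a ⟨⟨s, Algebra.subset_adjoin s.2⟩,
    Submonoid.subset_closure ⟨s.2, fun h => hs (Subtype.ext (congrArg (fun t : centralScalars 𝒜 => (t : Module.End F A)) h))⟩⟩

/-- The grading of `S⁻¹A`: the component of degree `g` consists of the `a / s` with
`a ∈ 𝒜 g`. -/
def locGrading (𝒜 : G → Submodule F A) (g : G) : Submodule F (CentralLocalization 𝒜) :=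
  Submodule.span F {x | ∃ a ∈ 𝒜 g, ∃ s : denominators 𝒜, x = AlgLocalization.mk (R := centralScalars 𝒜) a s}

end Graded

/-! ### The algebra of generic elements -/

section Generic

/-- The field of fractions of the polynomial ring over `F` in the variables `t_{ij}^g`,
`1 ≤ i, j ≤ n g`. -/
abbrev GenericField (F : Type*) {G : Type*} [Field F] (n : G → ℕ) : Type _ :=
  FractionRing (MvPolynomial (Σ g : G, Fin (n g) × Fin (n g)) F)

variable {F G U : Type*} [Field F] [NonUnitalNonAssocRing U] [Module F U]
  [IsScalarTower F U U] [SMulCommClass F U U]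
  (E : Type*) [Field E] [Algebra F E]

variable (F) in
/-- The variable `t_{ij}^g` as an element of an extension `E` of the generic field. -/
def genericVar (n : G → ℕ) [Algebra (GenericField F n) E] (g : G) (i j : Fin (n g)) : E :=
  algebraMap (GenericField F n) E
    (algebraMap (MvPolynomial (Σ g : G, Fin (n g) × Fin (n g)) F) (GenericField F n)
      (MvPolynomial.X ⟨g, i, j⟩))

variable {𝒰 : G → Submodule F U} {n : G → ℕ} [Algebra (GenericField F n) E]
  (u : ∀ g, Module.Basis (Fin (n g)) F (𝒰 g))

/-- The generic element `y_i^g = ∑ j, t_{ij}^g ⊗ u_j^g` of `E ⊗ U`. -/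
def genericElement (g : G) (i : Fin (n g)) : E ⊗[F] U :=
  ∑ j, genericVar F E n g i j ⊗ₜ[F] (u g j : U)

/-- The algebra of generic elements: the `F`-subalgebra of `E ⊗ U` generated by the `y_i^g`. -/
def genericAlgebra : NonUnitalSubalgebra F (E ⊗[F] U) :=
  NonUnitalAlgebra.adjoin F {y | ∃ (g : G) (i : Fin (n g)), y = genericElement E u g i}

/-- The algebra of generic elements `F_U` as a type. -/
def GenericAlg : Type _ := genericAlgebra E u

instance : NonUnitalNonAssocRing (GenericAlg E u) :=
  inferInstanceAs (NonUnitalNonAssocRing (genericAlgebra E u))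

instance : Module F (GenericAlg E u) := inferInstanceAs (Module F (genericAlgebra E u))

instance : IsScalarTower F (GenericAlg E u) (GenericAlg E u) :=
  inferInstanceAs (IsScalarTower F (genericAlgebra E u) (genericAlgebra E u))

instance : SMulCommClass F (GenericAlg E u) (GenericAlg E u) :=
  inferInstanceAs (SMulCommClass F (genericAlgebra E u) (genericAlgebra E u))

/-- The inclusion of `F_U` into `E ⊗ U`. -/
def GenericAlg.incl : GenericAlg E u →ₙₐ[F] E ⊗[F] U :=
  NonUnitalSubalgebraClass.subtype (genericAlgebra E u)

/-- The grading of the algebra of generic elements induced by `(E ⊗ U)_g = E ⊗ U_g`. -/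
def genericGrading (g : G) : Submodule F (GenericAlg E u) :=
  (((𝒰 g).baseChange E).restrictScalars F).comap (GenericAlg.incl E u : _ →ₗ[F] E ⊗[F] U)

/-- `Z_U`, the neutral component of the centre of `M(F_U)`. -/
abbrev genericCenter : NonUnitalSubalgebra F (Module.End F (GenericAlg E u)) :=
  neutralCenter (genericGrading E u)

/-- `S⁻¹F_U` for `S = Z_U \ {0}`. -/
abbrev GenericLoc : Type _ := CentralLocalization (genericGrading E u)

/-- The grading of `S⁻¹F_U`. -/
abbrev genericLocGrading : G → Submodule F (GenericLoc E u) := locGrading (genericGrading E u)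

/-- `K_U = Γ(S⁻¹F_U)_e`. -/
abbrev genericCentroid : Subalgebra F (Module.End F (GenericLoc E u)) :=
  neutralCentroid (genericLocGrading E u)

end Generic

end

open scoped TensorProduct IsMulCommutative

noncomputable section

set_option linter.unusedSectionVars false

/-! ### Homogeneous bases and homogeneous words in multiplication operators -/

section HomogeneousOperators

open Module

variable {k G A I : Type*} [Field k] [NonUnitalNonAssocRing A] [Module k A]

/-! Write `E` for the large field, `V = E ⊗ U`, and `R` for the algebra of generic elements inside
`V`. The matrices of variables `t_{ij}^g` are invertible over `E`, so the generic elements form a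
homogeneous `E`-basis `y` of `V` contained in `R`. Let `K` be the field of quotients of the scalars
`c : E` with `c • 1` in the multiplication algebra of `R`. The heart of the matter is that `K` is
large enough: every element of `R` has its `y`-coordinates in `K`. Then `S⁻¹F_U` is the `K`-span of
`y`, its extension to `E` is `V`, and the remaining assertions descend from `V`.

Density. As a module over the algebra generated by multiplications and homogeneous projections, `U`
is simple with endomorphisms `F`, so Jacobson's theorem makes every linear map between two
components a combination of words in homogeneous multiplications (`exists_mem_wordSpan_eqOn`). This
passes to `V`, with words over `R` and coefficients in `E` (`isDenseForm_genericAlgebra`).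

From coefficients in `E` to coefficients in `F`. If operators with coefficients in `E` separate
homogeneous elements `x i` of `R`, then some multilinear alternating expression in multiplications
is nonzero at `x`. Freeing its argument in position `t` gives an operator in the multiplication
algebra of `R` itself that kills every `x j` with `j ≠ t` but not `x t`
(`IsDenseForm.exists_mem_apply_eq_zero_of_ne`). Applied to a minimal set of basis vectors that
determines homogeneous operators, this yields a neutral `e` such that `e * a * e` is always a
multiple of `e` for neutral `a` (`IsDenseForm.exists_rank_one`).

Scalars. Quotients of the `c` with `c • e` in the multiplication algebra form a field
(`IsRankOne.scalarField`). The identity is a combination of operators `a * e * a'`; its coefficients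
can be moved into this field by a linear retraction, and clearing denominators produces nonzero
scalar operators (`IsRankOne.exists_smul_one_mem`). Hence this field is `K`. The operators killing
all but one basis vector of a degree then exhibit coordinates as ratios of proportional elements of
`R`, which lie in `K` (`IsDenseForm.repr_mem`).

Descent. Ideals and centroid elements of the `K`-span of `y` extend to `V`, where density decides
them, and a retraction from `E` to `K` brings ideals back. The polynomial identity is a standard
one, inherited from the finite-dimensional algebra `End E V`. -/

theorem basis_induction (b : Basis I k A) {p : A → Prop} (h0 : p 0)
    (hadd : ∀ x y, p x → p y → p (x + y)) (hsmul : ∀ (c : k) (x : A), p x → p (c • x))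
    (hbasis : ∀ i, p (b i)) (v : A) : p v := by
  induction b.mem_span v using Submodule.span_induction with
  | mem x hx => obtain ⟨i, rfl⟩ := hx; exact hbasis i
  | zero => exact h0
  | add x y _ _ hx hy => exact hadd x y hx hy
  | smul c x _ hx => exact hsmul c x hx

/-- `b` is a basis of homogeneous elements, with `b i` of degree `deg i`. -/
def IsHomogeneousBasis (𝒜 : G → Submodule k A) (b : Basis I k A) (deg : I → G) : Prop :=
  ∀ g, 𝒜 g = Submodule.span k (b '' (deg ⁻¹' {g}))

open Classical in
/-- The projection onto the component of degree `g`. -/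
def homogeneousProj (b : Basis I k A) (deg : I → G) (g : G) : End k A :=
  b.constr k fun i => if deg i = g then b i else 0

namespace IsHomogeneousBasis

variable {𝒜 : G → Submodule k A} {b : Basis I k A} {deg : I → G}

theorem basis_mem (hb : IsHomogeneousBasis 𝒜 b deg) (i : I) : b i ∈ 𝒜 (deg i) := by
  rw [hb]; exact Submodule.subset_span ⟨i, rfl, rfl⟩

theorem mem_iff (hb : IsHomogeneousBasis 𝒜 b deg) {g : G} {v : A} :
    v ∈ 𝒜 g ↔ ∀ i, deg i ≠ g → b.repr v i = 0 := by
  rw [hb, Basis.mem_span_image]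
  constructor
  · intro h i hi
    by_contra h0
    exact hi (h (Finsupp.mem_support_iff.2 h0))
  · intro h i hi
    by_contra h0
    exact Finsupp.mem_support_iff.1 hi (h i h0)

theorem induction_on (hb : IsHomogeneousBasis 𝒜 b deg) {g : G} {p : A → Prop} {v : A}
    (hv : v ∈ 𝒜 g) (h0 : p 0) (hadd : ∀ x y, p x → p y → p (x + y))
    (hsmul : ∀ (c : k) (x : A), p x → p (c • x)) (hbasis : ∀ i, deg i = g → p (b i)) : p v := by
  rw [hb] at hv
  induction hv using Submodule.span_induction with
  | mem x hx => obtain ⟨i, hi, rfl⟩ := hx; exact hbasis i hi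
  | zero => exact h0
  | add x y _ _ hx hy => exact hadd x y hx hy
  | smul c x _ hx => exact hsmul c x hx

theorem proj_basis_self (i : I) : homogeneousProj b deg (deg i) (b i) = b i := by
  simp [homogeneousProj, Basis.constr_basis]

theorem proj_basis_of_ne {i : I} {g : G} (h : deg i ≠ g) :
    homogeneousProj b deg g (b i) = 0 := by
  simp [homogeneousProj, Basis.constr_basis, h]

theorem proj_apply_of_mem (hb : IsHomogeneousBasis 𝒜 b deg) {g : G} {v : A} (hv : v ∈ 𝒜 g) :
    homogeneousProj b deg g v = v := by
  refine hb.induction_on (p := fun v => homogeneousProj b deg g v = v) hv (map_zero _) 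
    (fun x y hx hy => ?_) (fun c x hx => ?_) ?_
  · rw [map_add, hx, hy]
  · rw [map_smul, hx]
  · rintro i rfl; exact proj_basis_self i

theorem proj_apply_of_mem_of_ne (hb : IsHomogeneousBasis 𝒜 b deg) {g h : G} {v : A}
    (hv : v ∈ 𝒜 g) (hgh : g ≠ h) : homogeneousProj b deg h v = 0 := by
  refine hb.induction_on (p := fun v => homogeneousProj b deg h v = 0) hv (map_zero _) 
    (fun x y hx hy => ?_) (fun c x hx => ?_) ?_
  · rw [map_add, hx, hy, add_zero]
  · rw [map_smul, hx, smul_zero]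
  · rintro i rfl; exact proj_basis_of_ne hgh

theorem proj_mem (hb : IsHomogeneousBasis 𝒜 b deg) (g : G) (v : A) :
    homogeneousProj b deg g v ∈ 𝒜 g := by
  induction v using basis_induction b with
  | h0 => simp
  | hadd x y hx hy => rw [map_add]; exact add_mem hx hy
  | hsmul c x hx => rw [map_smul]; exact Submodule.smul_mem _ _ hx
  | hbasis i =>
    by_cases h : deg i = g
    · subst h; rw [proj_basis_self]; exact hb.basis_mem i
    · rw [proj_basis_of_ne h]; exact zero_mem _

open Classical in
theorem sum_proj [Fintype I] (v : A) :
    ∑ g ∈ Finset.univ.image deg, homogeneousProj b deg g v = v := by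
  suffices h : ∑ g ∈ Finset.univ.image deg, homogeneousProj b deg g = LinearMap.id by
    simpa using congr($h v)
  refine b.ext fun i => ?_
  rw [LinearMap.sum_apply, Finset.sum_eq_single (deg i)]
  · exact proj_basis_self i
  · intro g _ hg; exact proj_basis_of_ne hg.symm
  · intro h; exact absurd (Finset.mem_image_of_mem deg (Finset.mem_univ i)) h

end IsHomogeneousBasis

theorem exists_basis_apply_ne_zero (b : Basis I k A) {T : End k A} (hT : T ≠ 0) :
    ∃ i, T (b i) ≠ 0 := by
  by_contra! h
  exact hT (b.ext fun i => by simp [h i])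

variable [CommGroup G] [IsScalarTower k A A] [SMulCommClass k A A]

/-- Compositions of left and right multiplications by elements of the sets `H g`, together with
their degrees. -/
inductive HomogeneousWord (H : G → Set A) : G → End k A → Prop
  | one : HomogeneousWord H 1 1
  | left {g : G} {r : A} (hr : r ∈ H g) : HomogeneousWord H g (LinearMap.mulLeft k r)
  | right {g : G} {r : A} (hr : r ∈ H g) : HomogeneousWord H g (LinearMap.mulRight k r)
  | mul {g h : G} {m m' : End k A} (hm : HomogeneousWord H g m) (hm' : HomogeneousWord H h m') :
    HomogeneousWord H (g * h) (m * m')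

theorem HomogeneousWord.cast {H : G → Set A} {g h : G} {m : End k A}
    (hm : HomogeneousWord H g m) (e : g = h) : HomogeneousWord H h m := e ▸ hm

variable (k) in
/-- The span of the homogeneous words of degree `g`. -/
def wordSpan (H : G → Set A) (g : G) : Submodule k (End k A) :=
  Submodule.span k {m | HomogeneousWord H g m}

theorem HomogeneousWord.mem_wordSpan {H : G → Set A} {g : G} {m : End k A}
    (hm : HomogeneousWord H g m) : m ∈ wordSpan k H g := Submodule.subset_span hm

theorem mul_mem_wordSpan {H : G → Set A} {g h : G} {m m' : End k A} (hm : m ∈ wordSpan k H g)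
    (hm' : m' ∈ wordSpan k H h) : m * m' ∈ wordSpan k H (g * h) := by
  have : m * m' ∈ wordSpan k H g * wordSpan k H h := Submodule.mul_mem_mul hm hm'
  rw [wordSpan, wordSpan, Submodule.span_mul_span] at this
  refine Submodule.span_mono ?_ this
  rintro _ ⟨x, hx, y, hy, rfl⟩
  exact HomogeneousWord.mul hx hy

theorem wordSpan_cast {H : G → Set A} {g h : G} {m : End k A}
    (hm : m ∈ wordSpan k H g) (e : g = h) : m ∈ wordSpan k H h := e ▸ hm

theorem mapsTo_of_mem_wordSpan {𝒜 : G → Submodule k A} {H : G → Set A}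
    (hmul : ∀ {g h : G} {x y : A}, x ∈ 𝒜 g → y ∈ 𝒜 h → x * y ∈ 𝒜 (g * h))
    (hH : ∀ g, H g ⊆ 𝒜 g) {d : G} {m : End k A} (hm : m ∈ wordSpan k H d) {g : G} {v : A}
    (hv : v ∈ 𝒜 g) : m v ∈ 𝒜 (d * g) := by
  induction hm using Submodule.span_induction with
  | zero => exact zero_mem _
  | add x y _ _ hx hy => exact add_mem hx hy
  | smul c x _ hx => exact Submodule.smul_mem _ _ hx
  | mem x hx =>
    replace hx : HomogeneousWord H d x := hx
    induction hx generalizing g v with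
    | one => simpa using hv
    | left hr => exact hmul (hH _ hr) hv
    | @right d r hr => rw [mul_comm]; exact hmul hv (hH _ hr)
    | mul _ _ ih ih' => rw [mul_assoc]; exact ih (ih' hv)

/-- A linear map that does not vanish on an element of a span does not vanish on some
generator. -/
theorem exists_mem_of_apply_ne_zero {k M N : Type*} [Field k] [AddCommGroup M] [Module k M]
    [AddCommGroup N] [Module k N] {s : Set M} {x : M} (hx : x ∈ Submodule.span k s)
    (f : M →ₗ[k] N) (h : f x ≠ 0) : ∃ y ∈ s, f y ≠ 0 := by
  by_contra! h'
  exact h (Submodule.span_le.2 (show s ⊆ LinearMap.ker f from h') hx)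

/-! ### The density theorem for graded simple algebras -/

section Density

variable {𝒜 : G → Submodule k A} {b : Basis I k A} {deg : I → G}

/-- Adjoining the homogeneous projections turns graded simplicity into ordinary simplicity of a
module, so that Jacobson's density theorem applies. -/
theorem adjoin_mulLeft_mulRight_proj_eq_top [FiniteDimensional k A] [Finite I]
    (hA : IsGradedSimple 𝒜)
    (hΓ : neutralCentroid 𝒜 = ⊥) (hb : IsHomogeneousBasis 𝒜 b deg) :
    Algebra.adjoin k (Set.range (LinearMap.mulLeft k : A → _) ∪
      Set.range (LinearMap.mulRight k : A → _) ∪ Set.range (homogeneousProj b deg)) = ⊤ := by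
  classical
  have := Fintype.ofFinite I
  set M := Algebra.adjoin k (Set.range (LinearMap.mulLeft k : A → _) ∪
      Set.range (LinearMap.mulRight k : A → _) ∪ Set.range (homogeneousProj b deg)) with hM
  have hl (a : A) : LinearMap.mulLeft k a ∈ M := Algebra.subset_adjoin (Or.inl (Or.inl ⟨a, rfl⟩))
  have hr (a : A) : LinearMap.mulRight k a ∈ M := Algebra.subset_adjoin (Or.inl (Or.inr ⟨a, rfl⟩))
  have hp (g : G) : homogeneousProj b deg g ∈ M := Algebra.subset_adjoin (Or.inr ⟨g, rfl⟩)
  obtain ⟨x₀, y₀, hxy⟩ := hA.mul_ne_zero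
  have : Nontrivial A := ⟨_, _, hxy⟩
  -- A submodule is an ideal because `M` contains the multiplications, and is homogeneous because
  -- `M` contains the projections.
  have hsimple : IsSimpleModule M A := by
    refine { exists_pair_ne := ⟨⊥, ⊤, bot_ne_top⟩, eq_bot_or_eq_top := fun N => ?_ }
    have := hA.eq_bot_or_eq_top (N.restrictScalars k)
      (fun x hx a => ⟨N.smul_mem ⟨_, hl a⟩ hx, N.smul_mem ⟨_, hr a⟩ hx⟩) (by
        refine le_antisymm (fun x hx => ?_) (iSup_le fun g => inf_le_left)
        rw [← IsHomogeneousBasis.sum_proj (b := b) (deg := deg) x]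
        refine Submodule.sum_mem _ fun g _ => ?_
        exact Submodule.mem_iSup_of_mem g ⟨N.smul_mem ⟨_, hp g⟩ hx, hb.proj_mem g x⟩)
    rcases this with h | h
    · left; exact (Submodule.restrictScalars_eq_bot_iff k M A).1 h
    · right; exact (Submodule.restrictScalars_eq_top_iff k M A).1 h
  -- Commuting with the projections forces neutral degree, so an `M`-endomorphism lies in the
  -- neutral centroid.
  have hscal (φ : Module.End M A) : ∃ c : k, ∀ x, φ x = c • x := by
    have hcomm (m : Module.End k A) (hm : m ∈ M) (x : A) : φ (m x) = m (φ x) :=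
      φ.map_smul ⟨m, hm⟩ x
    have hle : mulAlgebra k A ≤ M.toNonUnitalSubalgebra := by
      refine NonUnitalAlgebra.adjoin_le ?_
      rintro _ (⟨a, rfl⟩ | ⟨a, rfl⟩)
      exacts [hl a, hr a]
    have hφ : (φ.restrictScalars k : Module.End k A) ∈ neutralCentroid 𝒜 := by
      refine ⟨fun m hm => LinearMap.ext fun x => hcomm m (hle hm) x, fun g x hx => ?_⟩
      have := hcomm _ (hp g) x
      rw [hb.proj_apply_of_mem hx] at this
      rw [LinearMap.restrictScalars_apply, this]
      exact hb.proj_mem g _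
    rw [hΓ] at hφ
    obtain ⟨c, hc⟩ := Algebra.mem_bot.1 hφ
    exact ⟨c, fun x => congr($hc.symm x)⟩
  refine eq_top_iff.2 fun T _ => ?_
  -- All `M`-endomorphisms being scalars, any `k`-linear `T` lies in the bicommutant, and density on
  -- a finite basis recovers it exactly.
  let f : Module.End (Module.End M A) A :=
    { toFun := T
      map_add' := T.map_add
      map_smul' := fun φ x => by
        obtain ⟨c, hc⟩ := hscal φ
        change T (φ x) = φ (T x)
        rw [hc, hc, map_smul] }
  obtain ⟨r, hr⟩ := jacobson_density f (Finset.univ.image b)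
  have : T = r.1 := b.ext fun i => hr (b i) (Finset.mem_image_of_mem _ (Finset.mem_univ i))
  rw [this]; exact r.2

/-- Every linear map between two components of a graded simple algebra with neutral centroid `k`
is induced by an element of the unital multiplication algebra of the appropriate degree. -/
theorem exists_mem_wordSpan_eqOn [FiniteDimensional k A] [Finite I] (hA : IsGradedSimple 𝒜)
    (hΓ : neutralCentroid 𝒜 = ⊥) (hb : IsHomogeneousBasis 𝒜 b deg) (T : End k A) (g h : G) :
    ∃ m ∈ wordSpan k (fun g => (𝒜 g : Set A)) (h * g⁻¹),
      ∀ v ∈ 𝒜 g, m v = homogeneousProj b deg h (T v) := by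
  classical
  have := Fintype.ofFinite I
  have hT : T ∈ Algebra.adjoin k (Set.range (LinearMap.mulLeft k : A → _) ∪
      Set.range (LinearMap.mulRight k : A → _) ∪ Set.range (homogeneousProj b deg)) := by
    rw [adjoin_mulLeft_mulRight_proj_eq_top hA hΓ hb]; trivial
  have hone (c : k) (g h : G) : ∃ m ∈ wordSpan k (fun g => (𝒜 g : Set A)) (h * g⁻¹),
      ∀ v ∈ 𝒜 g, m v = homogeneousProj b deg h (c • v) := by
    by_cases hgh : g = h
    · subst hgh
      refine ⟨c • 1, Submodule.smul_mem _ _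
        (HomogeneousWord.one.cast (mul_inv_cancel g).symm).mem_wordSpan, fun v hv => ?_⟩
      rw [map_smul, hb.proj_apply_of_mem hv]; rfl
    · refine ⟨0, zero_mem _, fun v hv => ?_⟩
      rw [map_smul, hb.proj_apply_of_mem_of_ne hv hgh, smul_zero]; rfl
  induction hT using Algebra.adjoin_induction generalizing g h with
  | algebraMap c => exact hone c g h
  | add S T _ _ hS hT =>
    obtain ⟨m, hm, e⟩ := hS g h
    obtain ⟨m', hm', e'⟩ := hT g h
    exact ⟨m + m', add_mem hm hm', fun v hv => by simp [e v hv, e' v hv]⟩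
  | mul S T _ _ hS hT =>
    choose m hm e using hS
    choose m' hm' e' using hT
    -- The sum of the projections is inserted between the two factors; `l` is the intermediate
    -- degree.
    refine ⟨∑ l ∈ Finset.univ.image deg, m l h * m' g l, Submodule.sum_mem _ fun l _ =>
      wordSpan_cast (mul_mem_wordSpan (hm l h) (hm' g l)) (by group), fun v hv => ?_⟩
    rw [LinearMap.sum_apply]
    conv_rhs => rw [Module.End.mul_apply,
      ← IsHomogeneousBasis.sum_proj (b := b) (deg := deg) (T v), map_sum, map_sum]
    refine Finset.sum_congr rfl fun l _ => ?_
    rw [Module.End.mul_apply, e' g l v hv, e l h _ (hb.proj_mem _ _)]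
  | mem S hS =>
    -- On `𝒜 g`, only the component of `u` of degree `h * g⁻¹` contributes to degree `h` in a
    -- product.
    have hsum (u v : A) (hv : v ∈ 𝒜 g) : homogeneousProj b deg (h * g⁻¹) u * v =
        homogeneousProj b deg h (u * v) ∧ v * homogeneousProj b deg (h * g⁻¹) u =
        homogeneousProj b deg h (v * u) := by
      induction u using basis_induction b with
      | h0 => simp
      | hadd x y hx hy => simp [add_mul, mul_add, hx.1, hy.1, hx.2, hy.2]
      | hsmul c x hx => simp [smul_mul_assoc, mul_smul_comm, hx.1, hx.2]
      | hbasis i =>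
        have h1 := hA.grading.mul_mem (hb.basis_mem i) hv
        have h2 := hA.grading.mul_mem hv (hb.basis_mem i)
        by_cases hi : deg i = h * g⁻¹
        · have h3 : deg i * g = h := by rw [hi]; group
          rw [hb.proj_apply_of_mem (hi ▸ hb.basis_mem i), hb.proj_apply_of_mem (h3 ▸ h1),
            hb.proj_apply_of_mem ((mul_comm _ _).trans h3 ▸ h2)]
          exact ⟨rfl, rfl⟩
        · have h3 : deg i * g ≠ h := fun h => hi (by rw [← h]; group)
          rw [IsHomogeneousBasis.proj_basis_of_ne hi, hb.proj_apply_of_mem_of_ne h1 h3,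
            hb.proj_apply_of_mem_of_ne h2 (mul_comm g _ ▸ h3)]
          simp
    rcases hS with (⟨u, rfl⟩ | ⟨u, rfl⟩) | ⟨l, rfl⟩
    · exact ⟨_, (HomogeneousWord.left (H := fun g => (𝒜 g : Set A))
        (hb.proj_mem (h * g⁻¹) u)).mem_wordSpan,
        fun v hv => (hsum u v hv).1⟩
    · exact ⟨_, (HomogeneousWord.right (H := fun g => (𝒜 g : Set A))
        (hb.proj_mem (h * g⁻¹) u)).mem_wordSpan,
        fun v hv => (hsum u v hv).2⟩
    · by_cases hl : g = l
      · subst hl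
        obtain ⟨m, hm, e⟩ := hone 1 g h
        exact ⟨m, hm, fun v hv => by rw [e v hv, hb.proj_apply_of_mem hv, one_smul]⟩
      · exact ⟨0, zero_mem _, fun v hv => by
          rw [hb.proj_apply_of_mem_of_ne hv hl, map_zero]; rfl⟩

end Density

end HomogeneousOperators

/-! ### Forms of graded algebras whose multiplication algebra is dense -/

section DenseForm

open Module

variable {F E G V I : Type*} [Field F] [Field E] [Algebra F E] [CommGroup G]
  [NonUnitalNonAssocRing V] [Module E V] [Module F V] [IsScalarTower F E V]
  [IsScalarTower E V V] [SMulCommClass E V V]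

/-- The homogeneous elements of degree `g` of the `F`-subalgebra `R`. -/
def homogeneousPart (𝒱 : G → Submodule E V) (R : NonUnitalSubalgebra F V) (g : G) : Set V :=
  {r | r ∈ R ∧ r ∈ 𝒱 g}

variable (E) in
/-- The nonunital `F`-algebra of operators generated by the multiplications by elements of `R`. -/
def subMulAlgebra (R : NonUnitalSubalgebra F V) : NonUnitalSubalgebra F (End E V) :=
  NonUnitalAlgebra.adjoin F (LinearMap.mulLeft E '' R ∪ LinearMap.mulRight E '' R)

theorem mulLeft_mem_subMulAlgebra {R : NonUnitalSubalgebra F V} {r : V} (hr : r ∈ R) :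
    LinearMap.mulLeft E r ∈ subMulAlgebra E R :=
  NonUnitalAlgebra.subset_adjoin F (Or.inl ⟨r, hr, rfl⟩)

theorem mulRight_mem_subMulAlgebra {R : NonUnitalSubalgebra F V} {r : V} (hr : r ∈ R) :
    LinearMap.mulRight E r ∈ subMulAlgebra E R :=
  NonUnitalAlgebra.subset_adjoin F (Or.inr ⟨r, hr, rfl⟩)

theorem apply_mem_of_mem_subMulAlgebra {R : NonUnitalSubalgebra F V} {m : End E V}
    (hm : m ∈ subMulAlgebra E R) {r : V} (hr : r ∈ R) : m r ∈ R := by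
  induction hm using NonUnitalAlgebra.adjoin_induction generalizing r with
  | mem m hm =>
    rcases hm with ⟨s, hs, rfl⟩ | ⟨s, hs, rfl⟩
    exacts [mul_mem hs hr, mul_mem hr hs]
  | add m m' _ _ h h' => exact add_mem (h hr) (h' hr)
  | zero => exact zero_mem R
  | mul m m' _ _ h h' => exact h (h' hr)
  | smul c m _ h => exact SMulMemClass.smul_mem c (h hr)

namespace HomogeneousWord

variable {𝒱 : G → Submodule E V} {R : NonUnitalSubalgebra F V} {d : G} {m n : End E V}

theorem apply_mem (hm : HomogeneousWord (homogeneousPart 𝒱 R) d m) {r : V} (hr : r ∈ R) :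
    m r ∈ R := by
  induction hm generalizing r with
  | one => exact hr
  | left h => exact mul_mem h.1 hr
  | right h => exact mul_mem hr h.1
  | mul _ _ ih ih' => exact ih (ih' hr)

/-- Words include the identity, which the nonunital algebra need not contain; a factor already in
the algebra absorbs this. -/
theorem mul_mem_subMulAlgebra (hm : HomogeneousWord (homogeneousPart 𝒱 R) d m)
    (hn : n ∈ subMulAlgebra E R) : m * n ∈ subMulAlgebra E R := by
  induction hm generalizing n with
  | one => rwa [one_mul]
  | left h => exact mul_mem (mulLeft_mem_subMulAlgebra h.1) hn
  | right h => exact mul_mem (mulRight_mem_subMulAlgebra h.1) hn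
  | mul _ _ ih ih' => rw [mul_assoc]; exact ih (ih' hn)

theorem mem_subMulAlgebra_mul (hm : HomogeneousWord (homogeneousPart 𝒱 R) d m)
    (hn : n ∈ subMulAlgebra E R) : n * m ∈ subMulAlgebra E R := by
  induction hm generalizing n with
  | one => rwa [mul_one]
  | left h => exact mul_mem hn (mulLeft_mem_subMulAlgebra h.1)
  | right h => exact mul_mem hn (mulRight_mem_subMulAlgebra h.1)
  | mul _ _ ih ih' => rw [← mul_assoc]; exact ih' (ih hn)

end HomogeneousWord

/-- `R` is an `F`-form, spanned by homogeneous elements, of a graded `E`-algebra `V` in which every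
linear map between components is induced by multiplications. -/
structure IsDenseForm (𝒱 : G → Submodule E V) (R : NonUnitalSubalgebra F V) (y : Basis I E V)
    (deg : I → G) : Prop where
  basis : IsHomogeneousBasis 𝒱 y deg
  mul_mem : ∀ {g h : G} {v w : V}, v ∈ 𝒱 g → w ∈ 𝒱 h → v * w ∈ 𝒱 (g * h)
  basis_mem : ∀ i, y i ∈ R
  mul_ne_zero : ∃ v w : V, v * w ≠ 0
  dense : ∀ (T : End E V) (g h : G), ∃ a ∈ wordSpan E (homogeneousPart 𝒱 R) (h * g⁻¹),
    ∀ v ∈ 𝒱 g, a v = homogeneousProj y deg h (T v)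

namespace IsDenseForm

variable {𝒱 : G → Submodule E V} {R : NonUnitalSubalgebra F V} {y : Basis I E V} {deg : I → G}

theorem basis_mem_part (hR : IsDenseForm 𝒱 R y deg) (i : I) :
    y i ∈ homogeneousPart 𝒱 R (deg i) := ⟨hR.basis_mem i, hR.basis.basis_mem i⟩

theorem mapsTo (hR : IsDenseForm 𝒱 R y deg) {d : G} {m : End E V}
    (hm : m ∈ wordSpan E (homogeneousPart 𝒱 R) d) {g : G} {v : V} (hv : v ∈ 𝒱 g) :
    m v ∈ 𝒱 (d * g) :=
  mapsTo_of_mem_wordSpan hR.mul_mem (fun _ _ h => h.2) hm hv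

theorem word_apply_mem_part (hR : IsDenseForm 𝒱 R y deg) {d : G} {m : End E V}
    (hm : HomogeneousWord (homogeneousPart 𝒱 R) d m) {g : G} {r : V}
    (hr : r ∈ homogeneousPart 𝒱 R g) : m r ∈ homogeneousPart 𝒱 R (d * g) :=
  ⟨hm.apply_mem hr.1, hR.mapsTo hm.mem_wordSpan hr.2⟩

/-- Density is applied to a rank-one map built from a functional that does not vanish at `v`. -/
theorem exists_apply_eq (hR : IsDenseForm 𝒱 R y deg) {g h : G} {v w : V} (hv : v ∈ 𝒱 g)
    (hv0 : v ≠ 0) (hw : w ∈ 𝒱 h) :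
    ∃ a ∈ wordSpan E (homogeneousPart 𝒱 R) (h * g⁻¹), a v = w := by
  obtain ⟨f, hf⟩ : ∃ f : Dual E V, f v ≠ 0 := by
    by_contra! H
    exact hv0 ((forall_dual_apply_eq_zero_iff E v).1 H)
  obtain ⟨a, ha, e⟩ := hR.dense (f.smulRight ((f v)⁻¹ • w)) g h
  refine ⟨a, ha, ?_⟩
  rw [e v hv, LinearMap.smulRight_apply, smul_smul, mul_inv_cancel₀ hf, one_smul,
    hR.basis.proj_apply_of_mem hw]

/-- Only nonvanishing is asked for, so the `E`-combination given by density can be traded for one of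
its words, which preserves `R`. -/
theorem exists_word_apply_ne_zero (hR : IsDenseForm 𝒱 R y deg) {g h d : G} {v w : V}
    (hv : v ∈ 𝒱 g) (hv0 : v ≠ 0) (hw : w ∈ 𝒱 h) {N : Type*} [AddCommGroup N] [Module E N]
    (φ : V →ₗ[E] N) (hφ : φ w ≠ 0) (hd : h * g⁻¹ = d) :
    ∃ m : End E V, HomogeneousWord (homogeneousPart 𝒱 R) d m ∧ φ (m v) ≠ 0 := by
  subst hd
  obtain ⟨a, ha, e⟩ := hR.exists_apply_eq hv hv0 hw
  exact exists_mem_of_apply_ne_zero ha (φ ∘ₗ LinearMap.applyₗ v) (by simpa [e] using hφ)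

/-- Density is applied to the map `f(·) w`, where the functional `f` vanishes at `v` but not at `w`.
-/
theorem exists_separating (hR : IsDenseForm 𝒱 R y deg) {g : G} {v w : V} (hv : v ∈ 𝒱 g)
    (hw : w ∈ 𝒱 g) (h : w ∉ Submodule.span E {v}) :
    ∃ a ∈ wordSpan E (homogeneousPart 𝒱 R) 1, a v = 0 ∧ a w ≠ 0 := by
  obtain ⟨f, hf, hf'⟩ := Submodule.exists_le_ker_of_notMem h
  have hw0 : w ≠ 0 := fun h0 => h (h0 ▸ zero_mem _)
  obtain ⟨a, ha, e⟩ := hR.dense (f.smulRight w) g g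
  refine ⟨a, wordSpan_cast ha (mul_inv_cancel g), ?_, ?_⟩
  · have : f v = 0 := hf' (Submodule.mem_span_singleton_self v)
    rw [e v hv, LinearMap.smulRight_apply, this, zero_smul, map_zero]
  · rw [e w hw, LinearMap.smulRight_apply, map_smul, hR.basis.proj_apply_of_mem hw]
    exact smul_ne_zero hf hw0

theorem exists_basis_mul_ne_zero (hR : IsDenseForm 𝒱 R y deg) : ∃ i j, y i * y j ≠ 0 := by
  by_contra! H
  obtain ⟨v, w, h⟩ := hR.mul_ne_zero
  refine h ?_
  have h1 (i : I) : LinearMap.mulLeft E (y i) = 0 := y.ext fun j => H i j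
  have h2 : LinearMap.mulRight E w = 0 := y.ext fun i => congr($(h1 i) w)
  exact congr($h2 v)

end IsDenseForm

/-! ### Alternating expressions in multiplication operators -/

/-- The maps `x ↦ m' * L_{m x}`, for words `m` and `m'`, of total degree `c`. -/
def sandwichMaps (H : G → Set V) (c : G) : Set (V →ₗ[E] End E V) :=
  {N | ∃ (d d' : G) (m m' : End E V), HomogeneousWord H d m ∧ HomogeneousWord H d' m' ∧ c = d' * d ∧
    ∀ x, N x = m' * LinearMap.mulLeft E (m x)}

theorem List.prod_ofFn_apply_eq_self {W : Type*} [AddCommGroup W] [Module E W] {k : ℕ}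
    (f : Fin k → End E W) (v : W) (h : ∀ i, f i v = v) : (List.ofFn f).prod v = v := by
  induction k with
  | zero => simp
  | succ k ih => rw [List.ofFn_succ, List.prod_cons, Module.End.mul_apply, ih _ fun i => h _, h]

namespace IsDenseForm

variable {𝒱 : G → Submodule E V} {R : NonUnitalSubalgebra F V} {y : Basis I E V} {deg : I → G}

theorem sandwich_word (hR : IsDenseForm 𝒱 R y deg) {N : V →ₗ[E] End E V} {c d : G}
    (hN : N ∈ sandwichMaps (homogeneousPart 𝒱 R) c) {x : V} (hx : x ∈ homogeneousPart 𝒱 R d) :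
    HomogeneousWord (homogeneousPart 𝒱 R) (c * d) (N x) := by
  obtain ⟨a, a', m, m', hm, hm', rfl, e⟩ := hN
  rw [e, mul_assoc]
  exact hm'.mul (.left (hR.word_apply_mem_part hm hx))

theorem prod_sandwich_apply_mem (hR : IsDenseForm 𝒱 R y deg) {k : ℕ} (N : Fin k → V →ₗ[E] End E V)
    (c : Fin k → G) (hN : ∀ i, N i ∈ sandwichMaps (homogeneousPart 𝒱 R) (c i)) (z : Fin k → V)
    (dz : Fin k → G) (hz : ∀ i, z i ∈ homogeneousPart 𝒱 R (dz i)) {v : V} {d : G}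
    (hv : v ∈ homogeneousPart 𝒱 R d) :
    (List.ofFn fun i => N i (z i)).prod v ∈ homogeneousPart 𝒱 R ((∏ i, (c i * dz i)) * d) := by
  induction k with
  | zero => simpa using hv
  | succ k ih =>
    rw [List.ofFn_succ, List.prod_cons, Module.End.mul_apply, Fin.prod_univ_succ, mul_assoc]
    exact hR.word_apply_mem_part (hR.sandwich_word (hN 0) (hz 0))
      (ih (fun i => N i.succ) (fun i => c i.succ) (fun i => hN _) (fun i => z i.succ)
        (fun i => dz i.succ) fun i => hz _)

/-- The product is read as a function of its argument in position `t`. Since `L_{m r} q = R_q (m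
r)`, it is a word applied to `r`; the factor `R_q` is a genuine multiplication, so the operator lies
in the nonunital algebra. -/
theorem prod_sandwich_update_word (hR : IsDenseForm 𝒱 R y deg) {k : ℕ}
    (N : Fin k → V →ₗ[E] End E V)
    (c : Fin k → G) (hN : ∀ i, N i ∈ sandwichMaps (homogeneousPart 𝒱 R) (c i)) (z : Fin k → V)
    (dz : Fin k → G) (hz : ∀ i, z i ∈ homogeneousPart 𝒱 R (dz i)) {v : V} {d : G}
    (hv : v ∈ homogeneousPart 𝒱 R d) (t : Fin k) :
    ∃ m ∈ subMulAlgebra E R, (∀ r, (List.ofFn fun i => N i (Function.update z t r i)).prod v = m r) ∧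
      HomogeneousWord (homogeneousPart 𝒱 R) ((∏ i, (c i * dz i)) * d * (dz t)⁻¹) m := by
  induction k with
  | zero => exact t.elim0
  | succ k ih =>
    refine Fin.cases ?_ (fun t => ?_) t
    -- The free argument sits in the outermost factor; `q` is the value of the remaining product at
    -- `v`.
    · obtain ⟨a, a', m, m', hm, hm', hc, e⟩ := hN 0
      have hq := hR.prod_sandwich_apply_mem (fun i => N i.succ) (fun i => c i.succ) (fun i => hN _)
        (fun i => z i.succ) (fun i => dz i.succ) (fun i => hz _) hv
      set q := (List.ofFn fun i : Fin k => N i.succ (z i.succ)).prod v with hqdef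
      refine ⟨m' * (LinearMap.mulRight E q * m), hm'.mul_mem_subMulAlgebra
        (hm.mem_subMulAlgebra_mul (mulRight_mem_subMulAlgebra hq.1)), fun r => ?_,
        (hm'.mul ((HomogeneousWord.right hq).mul hm)).cast ?_⟩
      · rw [List.ofFn_succ, List.prod_cons, Function.update_self, e]
        simp [hqdef]
      · rw [Fin.prod_univ_succ, hc, eq_mul_inv_iff_mul_eq]
        simp only [mul_assoc, mul_comm, mul_left_comm]
    · obtain ⟨m, hm, e, hw⟩ := ih (fun i => N i.succ) (fun i => c i.succ) (fun i => hN _)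
        (fun i => z i.succ) (fun i => dz i.succ) (fun i => hz _) t
      have h0 := hR.sandwich_word (hN 0) (hz 0)
      refine ⟨N 0 (z 0) * m, h0.mul_mem_subMulAlgebra hm, fun r => ?_, (h0.mul hw).cast ?_⟩
      · rw [List.ofFn_succ, List.prod_cons, Function.update_of_ne (Fin.succ_ne_zero t).symm,
          Module.End.mul_apply, Module.End.mul_apply, ← e]
        congr 3
        refine congrArg _ (funext fun i => ?_)
        by_cases hi : i = t
        · subst hi; simp
        · rw [Function.update_of_ne hi, Function.update_of_ne fun h => hi (Fin.succ_injective _ h)]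
      · rw [Fin.prod_univ_succ]
        simp only [mul_assoc]

end IsDenseForm

/-- The arguments are replaced by generators one at a time, the map being linear in each. -/
theorem MultilinearMap.exists_mem_apply_ne_zero {ι M N : Type*} [Finite ι]
    [AddCommGroup M] [Module E M] [AddCommGroup N] [Module E N]
    (Φ : MultilinearMap E (fun _ : ι => M) N) (s : ι → Set M) (a : ι → M)
    (ha : ∀ i, a i ∈ Submodule.span E (s i)) (h : Φ a ≠ 0) :
    ∃ b : ι → M, (∀ i, b i ∈ s i) ∧ Φ b ≠ 0 := by
  classical
  have := Fintype.ofFinite ι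
  suffices H : ∀ t : Finset ι, ∃ b : ι → M,
      (∀ i ∈ t, b i ∈ s i) ∧ (∀ i ∉ t, b i = a i) ∧ Φ b ≠ 0 by
    obtain ⟨b, hb, -, h⟩ := H Finset.univ
    exact ⟨b, fun i => hb i (Finset.mem_univ i), h⟩
  intro t
  induction t using Finset.induction_on with
  | empty => exact ⟨a, by simp, by simp, h⟩
  | insert j t hj ih =>
    obtain ⟨b, hb, hb', h⟩ := ih
    have hbj : b j ∈ Submodule.span E (s j) := hb' j hj ▸ ha j
    obtain ⟨x, hx, hx'⟩ := exists_mem_of_apply_ne_zero hbj (Φ.toLinearMap b j) (by simpa using h)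
    refine ⟨Function.update b j x, fun i hi => ?_, fun i hi => ?_, by simpa using hx'⟩
    · by_cases hij : i = j
      · subst hij; simpa using hx
      · rw [Function.update_of_ne hij]
        exact hb i ((Finset.mem_insert.1 hi).resolve_left hij)
    · rw [Finset.mem_insert, not_or] at hi
      rw [Function.update_of_ne hi.1]
      exact hb' i hi.2

theorem mul_mulLeft_mem_span_sandwichMaps {H : G → Set V} {d d' : G} {a a' : End E V}
    (ha : a ∈ wordSpan E H d) (ha' : a' ∈ wordSpan E H d') :
    (LinearMap.mulLeft E a').comp ((LinearMap.mul E V).comp a)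
      ∈ Submodule.span E (sandwichMaps H (d' * d)) := by
  induction ha using Submodule.span_induction with
  | zero => simp
  | add x z _ _ hx hz => simpa only [LinearMap.comp_add] using add_mem hx hz
  | smul r x _ hx => simpa only [LinearMap.comp_smul] using Submodule.smul_mem _ r hx
  | mem m hm =>
    induction ha' using Submodule.span_induction with
    | zero => simp
    | add x z _ _ hx hz =>
      have e : LinearMap.mulLeft E (x + z) = LinearMap.mulLeft E x + LinearMap.mulLeft E z :=
        LinearMap.ext fun v => add_mul x z v
      rw [e, LinearMap.add_comp]; exact add_mem hx hz
    | smul r x _ hx =>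
      have e : LinearMap.mulLeft E (r • x) = r • LinearMap.mulLeft E x :=
        LinearMap.ext fun v => smul_mul_assoc r x v
      rw [e, LinearMap.smul_comp]; exact Submodule.smul_mem _ r hx
    | mem m' hm' =>
      exact Submodule.subset_span ⟨d, d', m, m', hm, hm', rfl, fun x => rfl⟩

namespace IsDenseForm

variable {𝒱 : G → Submodule E V} {R : NonUnitalSubalgebra F V} {y : Basis I E V} {deg : I → G}

open Classical in
/-- If the elements `x i` are independent over the graded centroid, then multilinear alternating
expressions yield an operator in the multiplication algebra that kills all but one of them. -/
theorem exists_mem_apply_eq_zero_of_ne (hR : IsDenseForm 𝒱 R y deg) {k : ℕ} (x : Fin k → V)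
    (dx : Fin k → G) (hx : ∀ i, x i ∈ homogeneousPart 𝒱 R (dx i)) (c : Fin k → G)
    (a : Fin k → End E V) (ha : ∀ i, a i ∈ wordSpan E (homogeneousPart 𝒱 R) (c i))
    (ha0 : ∀ i j, j ≠ i → a i (x j) = 0) (ha1 : ∀ i, a i (x i) ≠ 0) (t : Fin k) :
    ∃ d, ∃ e ∈ subMulAlgebra E R, e ∈ wordSpan E (homogeneousPart 𝒱 R) d ∧ e (x t) ≠ 0 ∧
      ∀ j, j ≠ t → e (x j) = 0 := by
  obtain ⟨p, q, hpq⟩ := hR.exists_basis_mul_ne_zero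
  -- The operators are normalised so that `a' i` sends `a i (x i)` to `y p`, and `b` sends `y p * y
  -- q` back to `y q`.
  have h1 (i : Fin k) := hR.exists_apply_eq (hR.mapsTo (ha i) (hx i).2) (ha1 i)
    (hR.basis.basis_mem p)
  choose a' ha' ha'1 using h1
  obtain ⟨b, hb, hb1⟩ := hR.exists_apply_eq (hR.mul_mem (hR.basis.basis_mem p)
    (hR.basis.basis_mem q)) hpq (hR.basis.basis_mem q)
  let N₀ (i : Fin k) : V →ₗ[E] End E V :=
    (LinearMap.mulLeft E b).comp ((LinearMap.mul E V).comp (a' i * a i))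
  obtain ⟨C, hN₀⟩ : ∃ C : Fin k → G, ∀ i, N₀ i ∈ Submodule.span E
      (sandwichMaps (homogeneousPart 𝒱 R) (C i)) :=
    ⟨_, fun i => mul_mulLeft_mem_span_sandwichMaps (mul_mem_wordSpan (ha' i) (ha i)) hb⟩
  let Φ : MultilinearMap E (fun _ : Fin k => V →ₗ[E] End E V) V :=
    ∑ σ : Equiv.Perm (Fin k), Equiv.Perm.sign σ • (LinearMap.applyₗ (y q)).compMultilinearMap
      ((MultilinearMap.mkPiAlgebraFin E k (End E V)).compLinearMap
        fun i => LinearMap.applyₗ (x (σ i)))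
  have hΦ (N : Fin k → V →ₗ[E] End E V) : Φ N = ∑ σ : Equiv.Perm (Fin k),
      Equiv.Perm.sign σ • (List.ofFn fun i => N i (x (σ i))).prod (y q) := by
    simp [Φ]
  -- For the maps `N₀`, the identity permutation contributes `y q`, while any other permutation has
  -- a factor `N₀ i (x j)` with `j ≠ i`, which is zero.
  have hΦ₀ : Φ N₀ ≠ 0 := by
    rw [hΦ, Finset.sum_eq_single 1]
    · rw [Equiv.Perm.sign_one, one_smul, List.prod_ofFn_apply_eq_self]
      · exact y.ne_zero q
      · intro i
        simp [N₀, ha'1, hb1]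
    · intro σ _ hσ
      obtain ⟨i, hi⟩ : ∃ i, σ i ≠ i := by
        by_contra! H
        exact hσ (Equiv.ext H)
      rw [List.prod_eq_zero, LinearMap.zero_apply, smul_zero]
      refine List.mem_ofFn.2 ⟨i, ?_⟩
      ext v
      simp [N₀, ha0 i (σ i) hi]
    · simp
  -- The maps `N₀` have coefficients in `E`. Multilinearity in the maps replaces them by sandwich
  -- maps made of words over `R`.
  obtain ⟨N, hN, hN0⟩ := Φ.exists_mem_apply_ne_zero _ N₀ hN₀ hΦ₀
  let f : V [⋀^Fin k]→ₗ[E] V := MultilinearMap.alternatization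
    ((LinearMap.applyₗ (y q)).compMultilinearMap
      ((MultilinearMap.mkPiAlgebraFin E k (End E V)).compLinearMap N))
  have hf (z : Fin k → V) : f z = ∑ σ : Equiv.Perm (Fin k),
      Equiv.Perm.sign σ • (List.ofFn fun i => N i (z (σ i))).prod (y q) := by
    simp [f, MultilinearMap.alternatization_apply]
  have hword (σ : Equiv.Perm (Fin k)) := hR.prod_sandwich_update_word N _ hN (fun i => x (σ i))
    (fun i => dx (σ i)) (fun i => hx _) (hR.basis_mem_part q) (σ⁻¹ t)
  choose m hm hmr hmw using hword
  -- In the term of `σ`, the argument `x t` occupies position `σ⁻¹ t`.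
  have key : f.toMultilinearMap.toLinearMap x t = ∑ σ, Equiv.Perm.sign σ • m σ := by
    ext r
    rw [MultilinearMap.toLinearMap_apply, AlternatingMap.coe_multilinearMap, hf,
      LinearMap.sum_apply]
    refine Finset.sum_congr rfl fun σ _ => ?_
    rw [LinearMap.smul_apply, ← hmr]
    congr 4
    funext i
    congr 1
    by_cases hi : σ i = t
    · have : i = σ⁻¹ t := by rw [← hi]; simp
      rw [hi, this]; simp
    · rw [Function.update_of_ne hi, Function.update_of_ne]
      rintro rfl; simp at hi
  refine ⟨((∏ i, C i) * ∏ i, dx i) * deg q * (dx t)⁻¹, f.toMultilinearMap.toLinearMap x t,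
    ?_, ?_, ?_, fun j hj => ?_⟩
  rotate_left
  · rw [key]
    refine Submodule.sum_mem _ fun σ _ => ?_
    refine Submodule.smul_of_tower_mem _ _ ((hmw σ).cast ?_).mem_wordSpan
    have hσ : σ (σ⁻¹ t) = t := σ.apply_symm_apply t
    rw [Finset.prod_mul_distrib, hσ, Equiv.prod_comp σ dx]
  · rw [MultilinearMap.toLinearMap_apply, Function.update_eq_self]
    change f x ≠ 0
    rwa [hf, ← hΦ]
  -- With `x j` in position `t`, two arguments of an alternating map coincide.
  · exact f.map_update_self x hj.symm
  · rw [key]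
    refine sum_mem fun σ _ => ?_
    rcases Int.units_eq_one_or (Equiv.Perm.sign σ) with h | h <;> rw [h]
    · rw [one_smul]; exact hm σ
    · rw [Units.neg_smul, one_smul]; exact neg_mem (hm σ)

end IsDenseForm

end DenseForm

/-! ### Rank-one operators and the field of scalars -/

section DenseForm

open Module

variable {F E G V I : Type*} [Field F] [Field E] [Algebra F E] [CommGroup G]
  [NonUnitalNonAssocRing V] [Module E V] [Module F V] [IsScalarTower F E V]
  [IsScalarTower E V V] [SMulCommClass E V V]

namespace IsDenseForm

variable {𝒱 : G → Submodule E V} {R : NonUnitalSubalgebra F V} {y : Basis I E V} {deg : I → G}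

theorem exists_mem_apply_basis_eq_zero (hR : IsDenseForm 𝒱 R y deg) (Y : Finset I)
    (hY : ∀ i ∈ Y, ∃ c, ∃ a ∈ wordSpan E (homogeneousPart 𝒱 R) c, a (y i) ≠ 0 ∧
      ∀ j ∈ Y, j ≠ i → a (y j) = 0) {i : I} (hi : i ∈ Y) :
    ∃ d, ∃ e ∈ subMulAlgebra E R, e ∈ wordSpan E (homogeneousPart 𝒱 R) d ∧ e (y i) ≠ 0 ∧
      ∀ j ∈ Y, j ≠ i → e (y j) = 0 := by
  let s : Fin Y.card ≃ Y := Y.equivFin.symm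
  choose c a ha ha1 ha0 using fun i : Y => hY i i.2
  obtain ⟨d, e, he, he', h1, h0⟩ := hR.exists_mem_apply_eq_zero_of_ne (fun i => y (s i)) _
    (fun i => hR.basis_mem_part (s i)) (fun i => c (s i)) (fun i => a (s i)) (fun i => ha _)
    (fun i j hij => ha0 _ _ (s j).2 fun h => hij (s.injective (Subtype.ext h)))
    (fun i => ha1 _) (s.symm ⟨i, hi⟩)
  refine ⟨d, e, he, he', by simpa using h1, fun j hj hij => ?_⟩
  have := h0 (s.symm ⟨j, hj⟩) fun h => hij (congrArg Subtype.val (s.symm.injective h))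
  simpa using this

/-- There is an operator of neutral degree in the multiplication algebra of `R` which has rank one
over the graded centroid. -/
theorem exists_rank_one (hR : IsDenseForm 𝒱 R y deg) [Finite I] :
    ∃ e ∈ subMulAlgebra E R, e ∈ wordSpan E (homogeneousPart 𝒱 R) 1 ∧ (∃ i, e (y i) ≠ 0) ∧
      ∀ a ∈ wordSpan E (homogeneousPart 𝒱 R) 1, ∃ c : E, e * a * e = c • e := by
  classical
  have := Fintype.ofFinite I
  -- `P Y` says that a homogeneous operator is determined by its values on the `y i` with `i ∈ Y`.
  let P (Y : Finset I) : Prop := ∀ c, ∀ a ∈ wordSpan E (homogeneousPart 𝒱 R) c,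
    (∀ i ∈ Y, a (y i) = 0) → a = 0
  obtain ⟨Y, hY⟩ := exists_minimal_of_wellFoundedLT P
    ⟨Finset.univ, fun c a _ h => y.ext fun i => h i (Finset.mem_univ i)⟩
  have hYP : P Y := hY.prop
  have hYne : Y.Nonempty := by
    rw [Finset.nonempty_iff_ne_empty]
    rintro rfl
    obtain ⟨v, w, hvw⟩ := hR.mul_ne_zero
    have h1 := hYP 1 1 HomogeneousWord.one.mem_wordSpan (by simp)
    exact hvw congr($h1 (v * w))
  obtain ⟨i, hi⟩ := hYne
  -- By minimality some nonzero operator vanishes on `Y.erase j`; it cannot also vanish at `y j`,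
  -- since `Y` is determining.
  have hsep : ∀ j ∈ Y, ∃ c, ∃ a ∈ wordSpan E (homogeneousPart 𝒱 R) c, a (y j) ≠ 0 ∧
      ∀ l ∈ Y, l ≠ j → a (y l) = 0 := by
    intro j hj
    have hlt : ¬ P (Y.erase j) := fun h => Finset.notMem_erase j Y (hY.le_of_le h
      (Finset.erase_subset j Y) hj)
    simp only [P] at hlt
    push Not at hlt
    obtain ⟨c, a, ha, h0, hne⟩ := hlt
    have h0' : ∀ l ∈ Y, l ≠ j → a (y l) = 0 := fun l hl hlj =>
      h0 l (Finset.mem_erase.2 ⟨hlj, hl⟩)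
    refine ⟨c, a, ha, fun h => hne (hYP c a ha fun l hl => ?_), h0'⟩
    by_cases hlj : l = j
    · rw [hlj, h]
    · exact h0' l hl hlj
  obtain ⟨d, e, he, hed, he1, he0⟩ := hR.exists_mem_apply_basis_eq_zero Y hsep hi
  -- The operator `e` has degree `d`; a word of degree `d⁻¹` makes it neutral without killing its
  -- value at `y i`.
  obtain ⟨m, hm, hme⟩ := hR.exists_word_apply_ne_zero (hR.mapsTo hed (hR.basis.basis_mem i)) he1
    (hR.basis.basis_mem i) LinearMap.id (y.ne_zero i) (d := d⁻¹) (by group)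
  have hme1 : m * e ∈ wordSpan E (homogeneousPart 𝒱 R) 1 :=
    wordSpan_cast (mul_mem_wordSpan hm.mem_wordSpan hed) (inv_mul_cancel d)
  have hmei : (m * e) (y i) ∈ 𝒱 (deg i) := by
    simpa using hR.mapsTo hme1 (hR.basis.basis_mem i)
  refine ⟨m * e, hm.mul_mem_subMulAlgebra he, hme1, ⟨i, hme⟩, fun a ha => ?_⟩
  have hx : m * e * a * (m * e) ∈ wordSpan E (homogeneousPart 𝒱 R) 1 :=
    wordSpan_cast (mul_mem_wordSpan (mul_mem_wordSpan hme1 ha) hme1) (by simp)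
  -- Otherwise some `b` kills `(m * e) (y i)` but not this vector. Then `b * (m * e)` vanishes on
  -- all of `Y`, hence is zero, a contradiction.
  have hspan : (m * e * a * (m * e)) (y i) ∈ Submodule.span E {(m * e) (y i)} := by
    by_contra hn
    obtain ⟨b, hb, hb0, hb1⟩ := hR.exists_separating hmei (w := (m * e * a * (m * e)) (y i))
      (by simpa using hR.mapsTo hx (hR.basis.basis_mem i)) hn
    have hz : b * (m * e) = 0 := by
      refine hYP 1 _ (wordSpan_cast (mul_mem_wordSpan hb hme1) (by simp)) fun j hj => ?_
      by_cases hij : j = i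
      · subst hij; exact hb0
      · simp [he0 j hj hij]
    exact hb1 congr($hz ((a * (m * e)) (y i)))
  obtain ⟨c, hc⟩ := Submodule.mem_span_singleton.1 hspan
  refine ⟨c, sub_eq_zero.1 (hYP 1 _ (sub_mem hx (Submodule.smul_mem _ c hme1)) fun j hj => ?_)⟩
  by_cases hij : j = i
  · subst hij
    rw [LinearMap.sub_apply, ← hc, LinearMap.smul_apply, sub_self]
  · simp [he0 j hj hij]

end IsDenseForm

/-- An operator of neutral degree in the multiplication algebra of `R` which has rank one
over the graded centroid. -/
structure IsRankOne (𝒱 : G → Submodule E V) (R : NonUnitalSubalgebra F V) (e : End E V) : Prop where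
  mem : e ∈ subMulAlgebra E R
  mem_wordSpan : e ∈ wordSpan E (homogeneousPart 𝒱 R) 1
  exists_ne_zero : ∃ g, ∃ v ∈ homogeneousPart 𝒱 R g, e v ≠ 0
  mul_mul : ∀ a ∈ wordSpan E (homogeneousPart 𝒱 R) 1, ∃ c : E, e * a * e = c • e

namespace IsRankOne

variable {𝒱 : G → Submodule E V} {R : NonUnitalSubalgebra F V} {y : Basis I E V} {deg : I → G}
  {e : End E V}

theorem ne_zero (he : IsRankOne 𝒱 R e) : e ≠ 0 := by
  rintro rfl
  obtain ⟨g, v, -, h⟩ := he.exists_ne_zero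
  exact h rfl

/-- Nonzero homogeneous operators are detected by sandwiching them with `e`. -/
theorem exists_sandwich_ne_zero (he : IsRankOne 𝒱 R e) (hR : IsDenseForm 𝒱 R y deg) {d : G}
    {T : End E V} (hT : T ∈ wordSpan E (homogeneousPart 𝒱 R) d) (hT0 : T ≠ 0) :
    ∃ (f f' : G) (a a' : End E V), HomogeneousWord (homogeneousPart 𝒱 R) f a ∧
      HomogeneousWord (homogeneousPart 𝒱 R) f' a' ∧ f * d * f' = 1 ∧ e * (a * T * a') * e ≠ 0 := by
  obtain ⟨g, v, hv, hev⟩ := he.exists_ne_zero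
  obtain ⟨i, hi⟩ := exists_basis_apply_ne_zero y hT0
  have hev' : e v ∈ 𝒱 g := by simpa using hR.mapsTo he.mem_wordSpan hv.2
  -- Starting from `e v`, the word `a'` reaches a vector not killed by `T`, and then `a` reaches one
  -- not killed by `e`.
  obtain ⟨a', ha', h'⟩ := hR.exists_word_apply_ne_zero hev' hev (hR.basis.basis_mem i) T hi rfl
  have hTa' : T (a' (e v)) ∈ 𝒱 (d * (deg i * g⁻¹ * g)) :=
    hR.mapsTo hT (hR.mapsTo ha'.mem_wordSpan hev')
  obtain ⟨a, ha, h⟩ := hR.exists_word_apply_ne_zero hTa' h' hv.2 e hev rfl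
  refine ⟨_, _, a, a', ha, ha', ?_, fun h0 => h congr($h0 v)⟩
  rw [inv_mul_cancel_right, mul_inv_rev]
  simp [mul_assoc, mul_left_comm]

theorem exists_sandwich_eq_smul (he : IsRankOne 𝒱 R e) (hR : IsDenseForm 𝒱 R y deg) {d : G}
    {T : End E V} (hT : T ∈ wordSpan E (homogeneousPart 𝒱 R) d) (hT0 : T ≠ 0) :
    ∃ (f f' : G) (a a' : End E V) (c : E), HomogeneousWord (homogeneousPart 𝒱 R) f a ∧
      HomogeneousWord (homogeneousPart 𝒱 R) f' a' ∧ e * (a * T * a') * e = c • e ∧ c ≠ 0 := by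
  obtain ⟨f, f', a, a', ha, ha', h1, h⟩ := he.exists_sandwich_ne_zero hR hT hT0
  obtain ⟨c, hc⟩ := he.mul_mul (a * T * a') (wordSpan_cast (mul_mem_wordSpan
    (mul_mem_wordSpan ha.mem_wordSpan hT) ha'.mem_wordSpan) h1)
  refine ⟨f, f', a, a', c, ha, ha', hc, fun h0 => h ?_⟩
  rw [hc, h0, zero_smul]

/-- The square of `e` may be zero; a fixed word `a` between two copies of `e` gives a usable product
on the multiples of `e` in the multiplication algebra. -/
theorem exists_word_sandwich (he : IsRankOne 𝒱 R e) (hR : IsDenseForm 𝒱 R y deg) :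
    ∃ (f : G) (a : End E V) (c : E), HomogeneousWord (homogeneousPart 𝒱 R) f a ∧
      e * a * e = c • e ∧ c ≠ 0 := by
  have h1 : (1 : End E V) ≠ 0 := by
    obtain ⟨v, w, hvw⟩ := hR.mul_ne_zero
    exact fun h => hvw congr($h (v * w))
  obtain ⟨f, f', a, a', c, ha, ha', h, hc⟩ :=
    he.exists_sandwich_eq_smul hR HomogeneousWord.one.mem_wordSpan h1
  exact ⟨_, a * 1 * a', c, (ha.mul .one).mul ha', h, hc⟩

/-- Products `(s e) a (t e)` of multiples of `e` in the multiplication algebra. -/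
theorem smul_mem_mul {f : G} {a : End E V}
    {c s t : E} (ha : HomogeneousWord (homogeneousPart 𝒱 R) f a) (h : e * a * e = c • e)
    (hs : s • e ∈ subMulAlgebra E R) (ht : t • e ∈ subMulAlgebra E R) :
    (s * t * c) • e ∈ subMulAlgebra E R := by
  have := mul_mem (ha.mem_subMulAlgebra_mul hs) ht
  rw [smul_mul_assoc, smul_mul_assoc, mul_smul_comm, h, smul_smul, smul_smul] at this
  exact this

/-- The field of quotients of the `c ∈ E` with `c e` in the multiplication algebra of `R`. -/
def scalarField (he : IsRankOne 𝒱 R e) (hR : IsDenseForm 𝒱 R y deg) : Subfield E where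
  carrier := {c | ∃ s : E, s ≠ 0 ∧ s • e ∈ subMulAlgebra E R ∧ (c * s) • e ∈ subMulAlgebra E R}
  mul_mem' := by
    rintro c c' ⟨s, hs, h1, h2⟩ ⟨s', hs', h1', h2'⟩
    -- The common denominator is `s * s' * b`, the coefficient of `(s • e) * a * (s' • e)`.
    obtain ⟨f, a, b, ha, hab, hb⟩ := he.exists_word_sandwich hR
    refine ⟨s * s' * b, by simp [*], smul_mem_mul ha hab h1 h1', ?_⟩
    convert smul_mem_mul ha hab h2 h2' using 2
    ring
  one_mem' := ⟨1, one_ne_zero, by simpa using he.mem, by simpa using he.mem⟩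
  add_mem' := by
    rintro c c' ⟨s, hs, h1, h2⟩ ⟨s', hs', h1', h2'⟩
    obtain ⟨f, a, b, ha, hab, hb⟩ := he.exists_word_sandwich hR
    refine ⟨s * s' * b, by simp [*], smul_mem_mul ha hab h1 h1', ?_⟩
    convert add_mem (smul_mem_mul ha hab h2 h1') (smul_mem_mul ha hab h1 h2') using 1
    rw [← add_smul]
    congr 1
    ring
  zero_mem' := ⟨1, one_ne_zero, by simpa using he.mem, by simp⟩
  neg_mem' := by
    rintro c ⟨s, hs, h1, h2⟩
    exact ⟨s, hs, h1, by simpa [neg_mul, neg_smul] using h2⟩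
  inv_mem' := by
    rintro c ⟨s, hs, h1, h2⟩
    by_cases hc : c = 0
    · subst hc
      exact ⟨s, hs, h1, by simp⟩
    · exact ⟨c * s, by simp [*], h2, by rwa [inv_mul_cancel_left₀ hc]⟩

theorem mem_scalarField_of_smul_mem (he : IsRankOne 𝒱 R e) (hR : IsDenseForm 𝒱 R y deg) {c : E}
    (h : c • e ∈ subMulAlgebra E R) : c ∈ he.scalarField hR :=
  ⟨1, one_ne_zero, by simpa using he.mem, by simpa using h⟩

theorem mem_scalarField_of_smul_one_mem (he : IsRankOne 𝒱 R e) (hR : IsDenseForm 𝒱 R y deg)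
    {c : E} (h : c • (1 : End E V) ∈ subMulAlgebra E R) : c ∈ he.scalarField hR :=
  he.mem_scalarField_of_smul_mem hR (by simpa using mul_mem h he.mem)

theorem algebraMap_mem_scalarField (he : IsRankOne 𝒱 R e) (hR : IsDenseForm 𝒱 R y deg) (c : F) :
    algebraMap F E c ∈ he.scalarField hR :=
  he.mem_scalarField_of_smul_mem hR (by
    rw [algebraMap_smul]; exact SMulMemClass.smul_mem c he.mem)

/-- Two proportional nonzero homogeneous elements of `R` have their ratio in the scalar field. -/
theorem mem_scalarField_of_smul_mem_part (he : IsRankOne 𝒱 R e) (hR : IsDenseForm 𝒱 R y deg)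
    {c : E} {g : G} {v : V} (hv : v ∈ homogeneousPart 𝒱 R g) (hv0 : v ≠ 0) (hcv : c • v ∈ R) :
    c ∈ he.scalarField hR := by
  -- A word `m` moves `v` to an element whose left multiplication is nonzero; sandwiching the left
  -- multiplications by `m v` and `m (c • v)` gives `b • e` and `(c * b) • e`.
  obtain ⟨i, j, hij⟩ := hR.exists_basis_mul_ne_zero
  obtain ⟨m, hm, hmv⟩ := hR.exists_word_apply_ne_zero hv.2 hv0 (hR.basis.basis_mem i)
    (LinearMap.mul E V) (fun h => hij congr($h (y j))) rfl
  have hT := HomogeneousWord.left (k := E) (hR.word_apply_mem_part hm hv)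
  have hT' := HomogeneousWord.left (k := E)
    (hR.word_apply_mem_part hm ⟨hcv, (𝒱 g).smul_mem c hv.2⟩)
  obtain ⟨f, f', a, a', b, ha, ha', h, hb⟩ := he.exists_sandwich_eq_smul hR hT.mem_wordSpan hmv
  refine ⟨b, hb, ?_, ?_⟩
  · rw [← h]
    exact mul_mem (((ha.mul hT).mul ha').mem_subMulAlgebra_mul he.mem) he.mem
  · have e1 : LinearMap.mulLeft E (m (c • v)) = c • LinearMap.mulLeft E (m v) := by
      ext w; simp [smul_mul_assoc]
    have := mul_mem (((ha.mul hT').mul ha').mem_subMulAlgebra_mul he.mem) he.mem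
    rwa [e1, mul_smul_comm, smul_mul_assoc, mul_smul_comm, smul_mul_assoc, h, smul_smul] at this

/-- Denominators are combined by the product that inserts a word between two copies of `e`. -/
theorem exists_common_denominator (he : IsRankOne 𝒱 R e) (hR : IsDenseForm 𝒱 R y deg)
    {ι : Type*} (t : Finset ι) (c : ι → E) (hc : ∀ i ∈ t, c i ∈ he.scalarField hR) :
    ∃ s : E, s ≠ 0 ∧ s • e ∈ subMulAlgebra E R ∧ ∀ i ∈ t, (c i * s) • e ∈ subMulAlgebra E R := by
  classical
  induction t using Finset.induction_on with
  | empty => exact ⟨1, one_ne_zero, by simpa using he.mem, by simp⟩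
  | insert i t hi ih =>
    obtain ⟨s, hs, h1, h2⟩ := ih fun j hj => hc j (Finset.mem_insert_of_mem hj)
    obtain ⟨s', hs', h1', h2'⟩ := hc i (Finset.mem_insert_self i t)
    obtain ⟨f, a, b, ha, hab, hb⟩ := he.exists_word_sandwich hR
    refine ⟨s * s' * b, by simp [*], smul_mem_mul ha hab h1 h1', fun j hj => ?_⟩
    rcases Finset.mem_insert.1 hj with rfl | hj
    · convert smul_mem_mul ha hab h1 h2' using 2; ring
    · convert smul_mem_mul ha hab (h2 j hj) h1' using 2; ring

/-- The identity is a combination of operators `a * e * a'`. -/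
theorem one_mem_span (he : IsRankOne 𝒱 R e) (hR : IsDenseForm 𝒱 R y deg) [Finite I] :
    (1 : End E V) ∈ Submodule.span E {T | ∃ (d : G) (a a' : End E V),
      HomogeneousWord (homogeneousPart 𝒱 R) d a ∧ HomogeneousWord (homogeneousPart 𝒱 R) d⁻¹ a' ∧
      T = a * e * a'} := by
  classical
  have := Fintype.ofFinite I
  set J := Submodule.span E {T | ∃ (d : G) (a a' : End E V),
      HomogeneousWord (homogeneousPart 𝒱 R) d a ∧ HomogeneousWord (homogeneousPart 𝒱 R) d⁻¹ a' ∧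
      T = a * e * a'} with hJ
  have hdeg {T : End E V} (hT : T ∈ J) : T ∈ wordSpan E (homogeneousPart 𝒱 R) 1 := by
    refine Submodule.span_le.2 ?_ hT
    rintro _ ⟨d, a, a', ha, ha', rfl⟩
    exact wordSpan_cast (mul_mem_wordSpan (mul_mem_wordSpan ha.mem_wordSpan he.mem_wordSpan)
      ha'.mem_wordSpan) (by simp)
  have hmulw {T S : End E V} (hT : HomogeneousWord (homogeneousPart 𝒱 R) 1 T) (hS : S ∈ J) :
      T * S ∈ J := by
    induction hS using Submodule.span_induction with
    | zero => simp
    | add x z _ _ hx hz => rw [mul_add]; exact add_mem hx hz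
    | smul r x _ hx => rw [mul_smul_comm]; exact Submodule.smul_mem _ r hx
    | mem S hS =>
      obtain ⟨d, a, a', ha, ha', rfl⟩ := hS
      exact Submodule.subset_span ⟨d, T * a, a', (hT.mul ha).cast (one_mul d), ha',
        by simp only [mul_assoc]⟩
  have hmul {T S : End E V} (hT : T ∈ wordSpan E (homogeneousPart 𝒱 R) 1) (hS : S ∈ J) :
      T * S ∈ J := by
    induction hT using Submodule.span_induction with
    | zero => simp
    | add x z _ _ hx hz => rw [add_mul]; exact add_mem hx hz
    | smul r x _ hx => rw [smul_mul_assoc]; exact Submodule.smul_mem _ r hx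
    | mem T hT => exact hmulw hT hS
  have hspan {d d' : G} (hd : d * d' = 1) {a a' : End E V}
      (ha : a ∈ wordSpan E (homogeneousPart 𝒱 R) d)
      (ha' : a' ∈ wordSpan E (homogeneousPart 𝒱 R) d') : a * e * a' ∈ J := by
    obtain rfl : d' = d⁻¹ := eq_inv_of_mul_eq_one_right hd
    induction ha using Submodule.span_induction with
    | zero => simp
    | add x z _ _ hx hz => rw [add_mul, add_mul]; exact add_mem hx hz
    | smul r x _ hx => rw [smul_mul_assoc, smul_mul_assoc]; exact Submodule.smul_mem _ r hx
    | mem a ha =>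
      induction ha' using Submodule.span_induction with
      | zero => simp
      | add x z _ _ hx hz => rw [mul_add]; exact add_mem hx hz
      | smul r x _ hx => rw [mul_smul_comm]; exact Submodule.smul_mem _ r hx
      | mem a' ha' => exact Submodule.subset_span ⟨d, a, a', ha, ha', rfl⟩
  obtain ⟨g, v, hv, hev⟩ := he.exists_ne_zero
  have hev' : e v ∈ 𝒱 g := by simpa using hR.mapsTo he.mem_wordSpan hv.2
  -- On `𝒱 h`, the operator `a' i` is the `i`-th coordinate times `v`, and `a i` sends `e v` to the
  -- degree-`h` part of `y i`; summing over `i` gives the identity there.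
  have hone (h : G) : ∃ T ∈ J, ∀ w ∈ 𝒱 h, T w = w := by
    have h1 (i : I) := hR.dense (y.constr E fun j => if j = i then v else 0) h g
    choose a' ha' e' using h1
    have h2 (i : I) := hR.exists_apply_eq hev' hev (hR.basis.proj_mem h (y i))
    choose a ha e2 using h2
    refine ⟨∑ i, a i * e * a' i, Submodule.sum_mem _ fun i _ =>
      hspan (by group) (ha i) (ha' i), fun w hw => ?_⟩
    refine hR.basis.induction_on (p := fun w => (∑ i, a i * e * a' i) w = w) hw (map_zero _)
      (fun x z hx hz => by rw [map_add, hx, hz]) (fun c x hx => by rw [map_smul, hx]) ?_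
    rintro i rfl
    rw [LinearMap.sum_apply, Finset.sum_eq_single i]
    · simp only [Module.End.mul_apply]
      rw [e' i _ (hR.basis.basis_mem i), Basis.constr_basis, if_pos rfl,
        hR.basis.proj_apply_of_mem hv.2, e2, hR.basis.proj_apply_of_mem (hR.basis.basis_mem i)]
    · intro j _ hj
      simp only [Module.End.mul_apply]
      rw [e' j _ (hR.basis.basis_mem i), Basis.constr_basis, if_neg hj.symm]
      simp
    · simp
  have hall (s : Finset G) : ∃ T ∈ J, ∀ h ∈ s, ∀ w ∈ 𝒱 h, T w = w := by
    induction s using Finset.induction_on with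
    | empty => exact ⟨0, zero_mem _, by simp⟩
    | insert h s _ ih =>
      obtain ⟨T, hT, eT⟩ := ih
      obtain ⟨S, hS, eS⟩ := hone h
      -- Here `1 - (T + S - S * T) = (1 - S) * (1 - T)`, which vanishes where either factor does, as
      -- both operators are neutral.
      refine ⟨T + S - S * T, sub_mem (add_mem hT hS) (hmul (hdeg hS) hT), fun h' hh' w hw => ?_⟩
      rcases Finset.mem_insert.1 hh' with rfl | hh'
      · have : T w ∈ 𝒱 h' := by simpa using hR.mapsTo (hdeg hT) hw
        simp [eS w hw, eS _ this]
      · simp [eT h' hh' w hw]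
  obtain ⟨T, hT, eT⟩ := hall (Finset.univ.image deg)
  have : T = 1 := y.ext fun i =>
    eT _ (Finset.mem_image_of_mem _ (Finset.mem_univ i)) _ (hR.basis.basis_mem i)
  rwa [← this]

end IsRankOne

/-- This retraction brings linear relations over `E` down to `K`. -/
theorem Subfield.exists_retraction (K : Subfield E) : ∃ ρ : E →ₗ[K] K, ∀ c : K, ρ c = c := by
  obtain ⟨ρ, hρ⟩ := (Algebra.linearMap K E).exists_leftInverse_of_injective
    (LinearMap.ker_eq_bot.2 Subtype.val_injective)
  exact ⟨ρ, fun c => congr($hρ c)⟩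

namespace IsRankOne

variable {𝒱 : G → Submodule E V} {R : NonUnitalSubalgebra F V} {y : Basis I E V} {deg : I → G}
  {e : End E V}

/-- The identity is a combination of operators `a * e * a'` with coefficients in the scalar
field. -/
theorem exists_sum_eq_one (he : IsRankOne 𝒱 R e) (hR : IsDenseForm 𝒱 R y deg) [Finite I] :
    ∃ (t : Finset (End E V)) (k : End E V → he.scalarField hR),
      (∀ T ∈ t, ∃ (d : G) (a a' : End E V), HomogeneousWord (homogeneousPart 𝒱 R) d a ∧
        HomogeneousWord (homogeneousPart 𝒱 R) d⁻¹ a' ∧ T = a * e * a') ∧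
      ∑ T ∈ t, (k T : E) • T = 1 := by
  obtain ⟨b, t, ht, -, hsum⟩ := Submodule.mem_span_iff_exists_finset_subset.1 (he.one_mem_span hR)
  obtain ⟨ρ, hρ⟩ := Subfield.exists_retraction (he.scalarField hR)
  -- The coefficients are pushed into the scalar field by `ρ`. If the sum were no longer the
  -- identity, a sandwich by `e` would detect the difference.
  refine ⟨t, fun T => ρ (b T), fun T hT => ht hT, ?_⟩
  by_contra hne
  have hdeg : (1 : End E V) - ∑ T ∈ t, (ρ (b T) : E) • T ∈
      wordSpan E (homogeneousPart 𝒱 R) 1 := by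
    refine sub_mem HomogeneousWord.one.mem_wordSpan (Submodule.sum_mem _ fun T hT =>
      Submodule.smul_mem _ _ ?_)
    obtain ⟨d, a, a', ha, ha', rfl⟩ := ht hT
    exact wordSpan_cast (mul_mem_wordSpan (mul_mem_wordSpan ha.mem_wordSpan he.mem_wordSpan)
      ha'.mem_wordSpan) (by simp)
  obtain ⟨f, f', u, u', hu, hu', hff, h0⟩ :=
    he.exists_sandwich_ne_zero hR hdeg (sub_ne_zero.2 (Ne.symm hne))
  -- The sandwich turns the operators at hand into multiples of `e` lying in the multiplication
  -- algebra, so the multipliers belong to the scalar field.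
  have hc (T : End E V) (hT : T ∈ wordSpan E (homogeneousPart 𝒱 R) 1)
      (hT' : u * T * u' * e ∈ subMulAlgebra E R) :
      ∃ c : he.scalarField hR, e * (u * T * u') * e = (c : E) • e := by
    obtain ⟨c, hc⟩ := he.mul_mul _ (wordSpan_cast (mul_mem_wordSpan
      (mul_mem_wordSpan hu.mem_wordSpan hT) hu'.mem_wordSpan) hff)
    refine ⟨⟨c, he.mem_scalarField_of_smul_mem hR ?_⟩, hc⟩
    rw [← hc, mul_assoc]
    exact mul_mem he.mem hT'
  obtain ⟨c₁, hc₁⟩ := hc 1 HomogeneousWord.one.mem_wordSpan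
    (((hu.mul .one).mul hu').mul_mem_subMulAlgebra he.mem)
  have hcT (T : t) : ∃ c : he.scalarField hR, e * (u * T * u') * e = (c : E) • e := by
    obtain ⟨d, a, a', ha, ha', h⟩ := ht T.2
    rw [h]
    refine hc _ (wordSpan_cast (mul_mem_wordSpan (mul_mem_wordSpan ha.mem_wordSpan
      he.mem_wordSpan) ha'.mem_wordSpan) (by simp)) ?_
    have := hu.mul_mem_subMulAlgebra
      (ha.mul_mem_subMulAlgebra (mul_mem he.mem ((ha'.mul hu').mul_mem_subMulAlgebra he.mem)))
    simpa only [mul_assoc] using this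
  choose cT hcT using hcT
  have hsum' (b' : End E V → E) : e * (u * (∑ T ∈ t, b' T • T) * u') * e =
      (∑ T : t, b' T * cT T) • e := by
    rw [← Finset.sum_coe_sort]
    simp only [Finset.mul_sum, Finset.sum_mul, Finset.sum_smul, mul_smul_comm, smul_mul_assoc,
      hcT, smul_smul]
  have h1 : ∑ T : t, b T * cT T = (c₁ : E) := by
    have := hsum' b
    rw [hsum, hc₁] at this
    exact (smul_left_injective E he.ne_zero this).symm
  -- Apply `ρ` to `h1`: the `cT T` and `c₁` are in the scalar field, over which `ρ` is linear.
  have h2 : ∑ T : t, (ρ (b T) : E) * cT T = (c₁ : E) := by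
    have := congrArg ρ h1
    rw [map_sum, hρ] at this
    rw [← this, AddSubmonoidClass.coe_finsetSum]
    refine Finset.sum_congr rfl fun T _ => ?_
    rw [mul_comm (b T), mul_comm, ← smul_eq_mul, ← smul_eq_mul]
    exact (congrArg Subtype.val (ρ.map_smul (cT T) (b T))).symm
  refine h0 ?_
  rw [mul_sub, sub_mul, mul_sub, sub_mul, hc₁, hsum', h2, sub_self]

/-- The scalar field is the field of quotients of the scalars in the multiplication algebra. -/
theorem exists_smul_one_mem (he : IsRankOne 𝒱 R e) (hR : IsDenseForm 𝒱 R y deg) [Finite I]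
    {c : E} (hc : c ∈ he.scalarField hR) : ∃ p : E, p ≠ 0 ∧
      p • (1 : End E V) ∈ subMulAlgebra E R ∧ (c * p) • (1 : End E V) ∈ subMulAlgebra E R := by
  classical
  obtain ⟨t, k, ht, hsum⟩ := he.exists_sum_eq_one hR
  -- A single denominator serves both the coefficients `k T` and the products `c * k T`.
  obtain ⟨s, hs, -, h⟩ := he.exists_common_denominator hR (t ×ˢ Finset.univ)
    (fun T : End E V × Bool => if T.2 then c * k T.1 else k T.1) (by
      rintro ⟨T, _ | _⟩ -
      · exact (k T).2
      · exact mul_mem hc (k T).2)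
  -- Multiplying the decomposition of the identity by `b * s` makes each term `a * ((b * k T * s) •
  -- e) * a'`, which is in the multiplication algebra.
  have key (b : E) (hb : ∀ T ∈ t, (b * k T * s) • e ∈ subMulAlgebra E R) :
      (b * s) • (1 : End E V) ∈ subMulAlgebra E R := by
    rw [← hsum, Finset.smul_sum]
    refine sum_mem fun T hT => ?_
    obtain ⟨d, a, a', ha, ha', e'⟩ := ht T hT
    have := ha.mul_mem_subMulAlgebra (ha'.mem_subMulAlgebra_mul (hb T hT))
    rw [smul_mul_assoc, mul_smul_comm, ← mul_assoc, ← e'] at this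
    rwa [smul_smul, mul_right_comm]
  refine ⟨s, hs, ?_, key c fun T hT => ?_⟩
  · simpa using key 1 fun T hT => by
      simpa using h (T, false) (Finset.mem_product.2 ⟨hT, Finset.mem_univ _⟩)
  · simpa using h (T, true) (Finset.mem_product.2 ⟨hT, Finset.mem_univ _⟩)

end IsRankOne

/-! ### Coordinates and centroid of a dense form -/

namespace IsDenseForm

variable {𝒱 : G → Submodule E V} {R : NonUnitalSubalgebra F V} {y : Basis I E V} {deg : I → G}
  {e : End E V}

/-- Homogeneous elements of `R` have their coordinates in the scalar field. -/
theorem repr_mem_of_mem_part (hR : IsDenseForm 𝒱 R y deg) [Finite I] (he : IsRankOne 𝒱 R e)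
    {g : G} {r : V} (hr : r ∈ homogeneousPart 𝒱 R g) (i : I) :
    y.repr r i ∈ he.scalarField hR := by
  classical
  have := Fintype.ofFinite I
  by_cases hi : deg i = g
  swap
  · rw [hR.basis.mem_iff.1 hr.2 i hi]; exact zero_mem _
  obtain ⟨d, m, hm, hmd, h1, h0⟩ := hR.exists_mem_apply_basis_eq_zero
    (Finset.univ.filter fun i => deg i = g) (fun i hi' => by
      obtain ⟨a, ha, e⟩ := hR.dense (y.constr E fun j => if j = i then y i else 0) g g
      have hi' : deg i = g := (Finset.mem_filter.1 hi').2
      refine ⟨_, a, ha, ?_, fun j hj hji => ?_⟩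
      · rw [e _ (hi' ▸ hR.basis.basis_mem i), Basis.constr_basis, if_pos rfl,
          hR.basis.proj_apply_of_mem (hi' ▸ hR.basis.basis_mem i)]
        exact y.ne_zero i
      · rw [e _ ((Finset.mem_filter.1 hj).2 ▸ hR.basis.basis_mem j), Basis.constr_basis,
          if_neg hji, map_zero]) (Finset.mem_filter.2 ⟨Finset.mem_univ i, hi⟩)
  -- The operator `m` kills every other basis vector of degree `g`, so the coordinate appears as the
  -- ratio of two elements of `R`.
  have hmr : m r = y.repr r i • m (y i) := by
    conv_lhs => rw [← y.sum_repr r, map_sum]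
    rw [Finset.sum_eq_single i _ (by simp), map_smul]
    intro j _ hji
    rw [map_smul]
    by_cases hj : deg j = g
    · rw [h0 j (Finset.mem_filter.2 ⟨Finset.mem_univ j, hj⟩) hji, smul_zero]
    · rw [hR.basis.mem_iff.1 hr.2 j hj, zero_smul]
  refine he.mem_scalarField_of_smul_mem_part hR ⟨apply_mem_of_mem_subMulAlgebra hm
    (hR.basis_mem i), hR.mapsTo hmd (hR.basis.basis_mem i)⟩ h1 ?_
  rw [← hmr]
  exact apply_mem_of_mem_subMulAlgebra hm hr.1

/-- If `R` is generated by the homogeneous basis, then all elements of `R` have their coordinates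
in the scalar field. -/
theorem repr_mem [IsScalarTower F V V] [SMulCommClass F V V] (hR : IsDenseForm 𝒱 R y deg)
    [Finite I] (he : IsRankOne 𝒱 R e)
    (hgen : R = NonUnitalAlgebra.adjoin F (Set.range y)) {r : V} (hr : r ∈ R) (i : I) :
    y.repr r i ∈ he.scalarField hR := by
  have := Fintype.ofFinite I
  rw [hgen] at hr
  induction hr using NonUnitalAlgebra.adjoin_induction generalizing i with
  | mem r hr =>
    obtain ⟨j, rfl⟩ := hr
    exact hR.repr_mem_of_mem_part he (hR.basis_mem_part j) i
  | add r s _ _ h h' => rw [map_add]; exact add_mem (h i) (h' i)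
  | zero => simp
  | mul r s _ _ h h' =>
    -- Coordinates of a product involve the structure constants, which are coordinates of the
    -- homogeneous elements `y j * y l` of `R`.
    rw [← y.sum_repr r, ← y.sum_repr s, Finset.sum_mul_sum, map_sum, Finsupp.finsetSum_apply]
    refine sum_mem fun j _ => ?_
    rw [map_sum, Finsupp.finsetSum_apply]
    refine sum_mem fun l _ => ?_
    rw [smul_mul_smul_comm, map_smul, Finsupp.smul_apply, smul_eq_mul]
    exact MulMemClass.mul_mem (MulMemClass.mul_mem (h j) (h' l)) (hR.repr_mem_of_mem_part he
      ⟨MulMemClass.mul_mem (hR.basis_mem j) (hR.basis_mem l),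
        hR.mul_mem (hR.basis.basis_mem j) (hR.basis.basis_mem l)⟩ i)
  | smul c r _ h =>
    rw [← algebraMap_smul E c r, map_smul, Finsupp.smul_apply, smul_eq_mul]
    exact MulMemClass.mul_mem (he.algebraMap_mem_scalarField hR c) (h i)

/-- The neutral component of the centroid consists of scalars. -/
theorem exists_eq_smul_of_commute (hR : IsDenseForm 𝒱 R y deg) {T : End E V}
    (hl : ∀ r ∈ R, ∀ v, T (r * v) = r * T v) (hr : ∀ r ∈ R, ∀ v, T (v * r) = T v * r)
    (hn : ∀ g, ∀ v ∈ 𝒱 g, T v ∈ 𝒱 g) : ∃ c : E, ∀ v, T v = c • v := by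
  have hw {d : G} {a : End E V} (ha : a ∈ wordSpan E (homogeneousPart 𝒱 R) d) (v : V) :
      T (a v) = a (T v) := by
    induction ha using Submodule.span_induction generalizing v with
    | zero => simp
    | add x z _ _ hx hz => simp [hx, hz]
    | smul c x _ hx => simp [hx]
    | mem a ha =>
      replace ha : HomogeneousWord (homogeneousPart 𝒱 R) d a := ha
      induction ha generalizing v with
      | one => rfl
      | left h => exact hl _ h.1 v
      | right h => exact hr _ h.1 v
      | mul _ _ ih ih' => simp [ih, ih']
  obtain ⟨p, q, hpq⟩ := hR.exists_basis_mul_ne_zero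
  have hp := hR.basis.basis_mem p
  -- An operator separating `T (y p)` from `y p` cannot commute with `T`. The scalar found here
  -- spreads to all basis vectors by transitivity.
  have hspan : T (y p) ∈ Submodule.span E {y p} := by
    by_contra h
    obtain ⟨a, ha, h0, h1⟩ := hR.exists_separating hp (hn _ _ hp) h
    exact h1 (by rw [← hw ha, h0, map_zero])
  obtain ⟨c, hc⟩ := Submodule.mem_span_singleton.1 hspan
  refine ⟨c, fun v => ?_⟩
  suffices h : T = c • LinearMap.id from congr($h v)
  refine y.ext fun i => ?_
  obtain ⟨a, ha, h⟩ := hR.exists_apply_eq hp (y.ne_zero p) (hR.basis.basis_mem i)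
  rw [← h, hw ha, ← hc, map_smul]
  rfl

/-- The field of quotients of the scalars in the multiplication algebra of `R`. -/
theorem exists_scalarField [IsScalarTower F V V] [SMulCommClass F V V]
    (hR : IsDenseForm 𝒱 R y deg) [Finite I]
    (hgen : R = NonUnitalAlgebra.adjoin F (Set.range y)) :
    ∃ K : Subfield E, (∀ c ∈ K, ∃ p : E, p ≠ 0 ∧ p • (1 : End E V) ∈ subMulAlgebra E R ∧
        (c * p) • (1 : End E V) ∈ subMulAlgebra E R) ∧
      (∀ c : E, c • (1 : End E V) ∈ subMulAlgebra E R → c ∈ K) ∧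
      ∀ r ∈ R, ∀ i, y.repr r i ∈ K := by
  obtain ⟨e, he, he1, ⟨i, hi⟩, h⟩ := hR.exists_rank_one
  have he : IsRankOne 𝒱 R e := ⟨he, he1, ⟨_, _, hR.basis_mem_part i, hi⟩, h⟩
  exact ⟨he.scalarField hR, fun c hc => he.exists_smul_one_mem hR hc,
    fun c hc => he.mem_scalarField_of_smul_one_mem hR hc, fun r hr => hR.repr_mem he hgen hr⟩

end IsDenseForm

end DenseForm

/-! ### The standard identity -/

section StandardIdentity

open Module

/-- The standard polynomial of degree `N`. -/
def standardPolynomial (F : Type*) [Field F] (N : ℕ) : FreeAlgebra F ℕ :=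
  ∑ σ : Equiv.Perm (Fin N), Equiv.Perm.sign σ •
    (List.ofFn fun i => FreeAlgebra.ι F (σ i : ℕ)).prod

theorem FreeMonoid.ofList_ofFn {X : Type*} (N : ℕ) (f : Fin N → X) :
    FreeMonoid.ofList (List.ofFn f) = (List.ofFn fun i => FreeMonoid.of (f i)).prod := by
  induction N with
  | zero => rfl
  | succ N ih => rw [List.ofFn_succ, List.ofFn_succ, List.prod_cons, ← ih]; rfl

/-- Distinct permutations give distinct monomials, so no cancellation occurs; the identity has
coefficient one. -/
theorem standardPolynomial_ne_zero (F : Type*) [Field F] (N : ℕ) :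
    standardPolynomial F N ≠ 0 := by
  intro h
  have h1 := congrArg (FreeAlgebra.equivMonoidAlgebraFreeMonoid (R := F) (X := ℕ)) h
  have hσ (σ : Equiv.Perm (Fin N)) : FreeAlgebra.equivMonoidAlgebraFreeMonoid (R := F)
      (List.ofFn fun i => FreeAlgebra.ι F (σ i : ℕ)).prod =
      MonoidAlgebra.basis (FreeMonoid ℕ) F (FreeMonoid.ofList (List.ofFn fun i => (σ i : ℕ))) := by
    rw [map_list_prod, List.map_ofFn, MonoidAlgebra.basis_apply, FreeMonoid.ofList_ofFn,
      ← MonoidAlgebra.of_apply, map_list_prod, List.map_ofFn]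
    congr 2
    funext i
    simp [FreeAlgebra.equivMonoidAlgebraFreeMonoid]
  have hs : ∀ (s : ℤˣ) (x : FreeAlgebra F ℕ),
      FreeAlgebra.equivMonoidAlgebraFreeMonoid (s • x) =
        ((s : ℤ) : F) • FreeAlgebra.equivMonoidAlgebraFreeMonoid x := fun s x => by
    rcases Int.units_eq_one_or s with h | h <;> simp [h]
  have hli := (MonoidAlgebra.basis (FreeMonoid ℕ) F).linearIndependent.comp
    (fun σ : Equiv.Perm (Fin N) => FreeMonoid.ofList (List.ofFn fun i => (σ i : ℕ)))
    (fun σ σ' h => Equiv.ext fun i => Fin.ext (congrFun (List.ofFn_injective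
      (FreeMonoid.ofList.injective h)) i))
  simp only [standardPolynomial, map_sum, hs, hσ, map_zero] at h1
  simpa using Fintype.linearIndependent_iff.1 hli _ h1 1

/-- The polynomial is alternating and multilinear over `E` in `finrank E W + 1` elements, which are
linearly dependent. -/
theorem lift_standardPolynomial_eq_zero {F E W : Type*} [Field F] [Field E] [Algebra F E]
    [Ring W] [Algebra E W] [Algebra F W] [IsScalarTower F E W] [FiniteDimensional E W]
    (m : ℕ → W) : FreeAlgebra.lift F m (standardPolynomial F (finrank E W + 1)) = 0 := by
  have h := AlternatingMap.map_linearDependent (K := E) (MultilinearMap.alternatization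
    (MultilinearMap.mkPiAlgebraFin E (finrank E W + 1) W)) (fun i => m i) (fun hli => by
      have := hli.fintype_card_le_finrank
      simp at this)
  rw [MultilinearMap.alternatization_apply] at h
  rw [standardPolynomial, map_sum, ← h]
  refine Finset.sum_congr rfl fun σ _ => ?_
  have hs : ∀ (s : ℤˣ) (x : FreeAlgebra F ℕ),
      FreeAlgebra.lift F m (s • x) = s • FreeAlgebra.lift F m x := fun s x => by
    rcases Int.units_eq_one_or s with h | h <;> simp [h]
  rw [hs, map_list_prod, List.map_ofFn]
  congr 1
  simp [Function.comp_def]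

end StandardIdentity

/-! ### Descent to a subfield of scalars -/

section ScalarForm

open Module

variable {F E G V W I : Type*} [Field F] [Field E] [Algebra F E] [CommGroup G]
  [NonUnitalNonAssocRing V] [Module E V] [Module F V] [IsScalarTower F E V]
  [IsScalarTower E V V] [SMulCommClass E V V]
  [NonUnitalNonAssocRing W] [Module F W] [IsScalarTower F W W] [SMulCommClass F W W]

/-- `j` identifies the graded algebra `W` with the algebra of those elements of `V` that have
coordinates in the subfield `K`. -/
structure IsScalarForm (𝒱 : G → Submodule E V) (y : Basis I E V) (K : Subfield E)
    (𝒲 : G → Submodule F W) (j : W →ₗ[F] V) : Prop where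
  injective : Function.Injective j
  map_mul : ∀ x x', j (x * x') = j x * j x'
  mem_iff : ∀ {g x}, x ∈ 𝒲 g ↔ j x ∈ 𝒱 g
  repr_mem : ∀ x i, y.repr (j x) i ∈ K
  exists_eq : ∀ v, (∀ i, y.repr v i ∈ K) → ∃ x, j x = v

namespace IsScalarForm

variable {𝒱 : G → Submodule E V} {R : NonUnitalSubalgebra F V} {y : Basis I E V} {deg : I → G}
  {K : Subfield E} {𝒲 : G → Submodule F W} {j : W →ₗ[F] V}

theorem exists_apply_eq_smul_basis (hj : IsScalarForm 𝒱 y K 𝒲 j) {c : E} (hc : c ∈ K) (i : I) :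
    ∃ x, j x = c • y i := by
  classical
  refine hj.exists_eq _ fun l => ?_
  rw [map_smul, Basis.repr_self, Finsupp.smul_single, Finsupp.single_apply]
  split_ifs
  · simpa using hc
  · exact zero_mem K

theorem exists_apply_eq_basis (hj : IsScalarForm 𝒱 y K 𝒲 j) (i : I) : ∃ x, j x = y i := by
  simpa using hj.exists_apply_eq_smul_basis (one_mem K) i

theorem exists_lift (hj : IsScalarForm 𝒱 y K 𝒲 j) {m : End F W} (hm : m ∈ mulAlgebra F W) :
    ∃ T : End E V, ∀ x, j (m x) = T (j x) := by
  induction hm using NonUnitalAlgebra.adjoin_induction with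
  | mem m hm =>
    rcases hm with ⟨a, rfl⟩ | ⟨a, rfl⟩
    · exact ⟨LinearMap.mulLeft E (j a), hj.map_mul a⟩
    · exact ⟨LinearMap.mulRight E (j a), fun x => hj.map_mul x a⟩
  | add m m' _ _ h h' =>
    obtain ⟨T, hT⟩ := h
    obtain ⟨T', hT'⟩ := h'
    exact ⟨T + T', fun x => by simp [hT, hT']⟩
  | zero => exact ⟨0, by simp⟩
  | mul m m' _ _ h h' =>
    obtain ⟨T, hT⟩ := h
    obtain ⟨T', hT'⟩ := h'
    exact ⟨T * T', fun x => by simp [hT, hT']⟩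
  | smul c m _ h =>
    obtain ⟨T, hT⟩ := h
    exact ⟨c • T, fun x => by simp [hT]⟩

/-- The factor `k` can be absorbed into one multiplication because `j` has image stable under `K`.
-/
theorem exists_mem_mulAlgebra (hj : IsScalarForm 𝒱 y K 𝒲 j)
    (hRK : ∀ r ∈ R, ∀ i, y.repr r i ∈ K) {T : End E V} (hT : T ∈ subMulAlgebra E R)
    {k : E} (hk : k ∈ K) : ∃ m ∈ mulAlgebra F W, ∀ x, j (m x) = k • T (j x) := by
  induction hT using NonUnitalAlgebra.adjoin_induction generalizing k with
  | mem T hT =>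
    have hr (r : V) (hr : r ∈ R) : ∃ w, j w = k • r := hj.exists_eq _ fun i => by
      rw [map_smul, Finsupp.smul_apply, smul_eq_mul]
      exact mul_mem hk (hRK r hr i)
    rcases hT with ⟨r, h, rfl⟩ | ⟨r, h, rfl⟩
    · obtain ⟨w, hw⟩ := hr r h
      exact ⟨_, mulLeft_mem_mulAlgebra w, fun x => by simp [hj.map_mul, hw, smul_mul_assoc]⟩
    · obtain ⟨w, hw⟩ := hr r h
      exact ⟨_, mulRight_mem_mulAlgebra w, fun x => by simp [hj.map_mul, hw, mul_smul_comm]⟩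
  | add T T' _ _ h h' =>
    obtain ⟨m, hm, e⟩ := h hk
    obtain ⟨m', hm', e'⟩ := h' hk
    exact ⟨m + m', add_mem hm hm', fun x => by simp [e, e']⟩
  | zero => exact ⟨0, zero_mem _, by simp⟩
  | mul T T' _ _ h h' =>
    obtain ⟨m, hm, e⟩ := h hk
    obtain ⟨m', hm', e'⟩ := h' (one_mem K)
    exact ⟨m * m', mul_mem hm hm', fun x => by simp [e, e']⟩
  | smul c T _ h =>
    obtain ⟨m, hm, e⟩ := h hk
    exact ⟨c • m, SMulMemClass.smul_mem c hm, fun x => by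
      rw [LinearMap.smul_apply, map_smul, e, LinearMap.smul_apply, smul_comm]⟩

/-- If `p • 1` comes from `R`, then `k • 1 = (k * p⁻¹) • (p • 1)`; inverting `p` is possible after
passing to `W`. -/
theorem exists_scalar_mem_mulAlgebra (hj : IsScalarForm 𝒱 y K 𝒲 j)
    (hRK : ∀ r ∈ R, ∀ i, y.repr r i ∈ K)
    (hK : ∀ c ∈ K, ∃ p : E, p ≠ 0 ∧ p • (1 : End E V) ∈ subMulAlgebra E R ∧
        (c * p) • (1 : End E V) ∈ subMulAlgebra E R)
    (hK' : ∀ c : E, c • (1 : End E V) ∈ subMulAlgebra E R → c ∈ K)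
    {k : E} (hk : k ∈ K) : ∃ m ∈ mulAlgebra F W, ∀ x, j (m x) = k • j x := by
  obtain ⟨p, hp, h, -⟩ := hK 1 (one_mem K)
  obtain ⟨m, hm, e⟩ := hj.exists_mem_mulAlgebra hRK h (mul_mem hk (inv_mem (hK' p h)))
  exact ⟨m, hm, fun x => by simp [e, smul_smul, hp]⟩

/-- The multiplication algebra satisfies a standard identity. -/
theorem satisfiesPI (hj : IsScalarForm 𝒱 y K 𝒲 j) [Finite I] :
    SatisfiesPI (mulAlgebra F W) := by
  have := Module.Finite.of_basis y
  refine ⟨standardPolynomial F (finrank E (End E V) + 1), standardPolynomial_ne_zero _ _,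
    fun m hm => ?_⟩
  choose T hT using fun i => hj.exists_lift (hm i)
  have key (f : FreeAlgebra F ℕ) (x : W) :
      j (FreeAlgebra.lift F m f x) = FreeAlgebra.lift F T f (j x) := by
    induction f using FreeAlgebra.induction generalizing x with
    | grade0 c => simp [Module.algebraMap_end_apply]
    | grade1 i => simp [hT]
    | mul a b ha hb => simp [ha, hb]
    | add a b ha hb => simp [ha, hb]
  ext x
  refine hj.injective ?_
  rw [key, lift_standardPolynomial_eq_zero]
  simp

/-- Apply the retraction to the coordinates of a relation `j x = ∑ c l • j (w l)`. The coefficients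
become elements of `K`, which act on `W` through its multiplication algebra and so preserve `J`. -/
theorem mem_of_mem_span (hj : IsScalarForm 𝒱 y K 𝒲 j)
    (hscal : ∀ k ∈ K, ∃ m ∈ mulAlgebra F W, ∀ x, j (m x) = k • j x) {J : Submodule F W}
    (hJ : ∀ m ∈ mulAlgebra F W, ∀ x ∈ J, m x ∈ J) {x : W}
    (hx : j x ∈ Submodule.span E (j '' J)) : x ∈ J := by
  obtain ⟨ρ, hρ⟩ := Subfield.exists_retraction K
  obtain ⟨n, c, z, hz⟩ := Submodule.mem_span_set'.1 hx
  choose w hw hwz using fun l => (z l).2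
  choose m hm e using fun l => hscal _ (ρ (c l)).2
  have : x = ∑ l, m l (w l) := by
    refine hj.injective (y.ext_elem fun i => ?_)
    have h1 : (ρ (y.repr (j x) i) : E) = y.repr (j x) i :=
      congrArg Subtype.val (hρ ⟨_, hj.repr_mem x i⟩)
    rw [← h1, ← hz, map_sum, map_sum, map_sum, Finsupp.finsetSum_apply, Finsupp.finsetSum_apply,
      map_sum, AddSubmonoidClass.coe_finsetSum]
    refine Finset.sum_congr rfl fun l _ => ?_
    rw [e, map_smul, map_smul, Finsupp.smul_apply, Finsupp.smul_apply, ← hwz, smul_eq_mul,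
      smul_eq_mul, mul_comm, mul_comm _ (y.repr (j (w l)) i)]
    exact congrArg Subtype.val (ρ.map_smul ⟨_, hj.repr_mem (w l) i⟩ (c l))
  rw [this]
  exact sum_mem fun l _ => hJ _ (hm l) _ (hw l)

theorem isGradedSimple (hj : IsScalarForm 𝒱 y K 𝒲 j) (hR : IsDenseForm 𝒱 R y deg) [Finite I]
    (hRK : ∀ r ∈ R, ∀ i, y.repr r i ∈ K)
    (hscal : ∀ k ∈ K, ∃ m ∈ mulAlgebra F W, ∀ x, j (m x) = k • j x) :
    IsGradedSimple 𝒲 := by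
  classical
  have := Fintype.ofFinite I
  refine ⟨⟨fun g => ?_, ?_, ?_⟩, ?_, fun J hJ hhom => ?_⟩
  · rw [Submodule.disjoint_def]
    intro x hx hx'
    have h1 : ∀ i, deg i = g → y.repr (j x) i = 0 := by
      intro i hi
      let N : Submodule F W := LinearMap.ker ((y.coord i).restrictScalars F ∘ₗ j)
      have : (⨆ h, ⨆ _ : h ≠ g, 𝒲 h) ≤ N := by
        refine iSup₂_le fun h hh z hz => ?_
        exact hR.basis.mem_iff.1 (hj.mem_iff.1 hz) i fun h' => hh (h'.symm.trans hi)
      exact this hx'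
    refine hj.injective (y.ext_elem fun i => ?_)
    by_cases hi : deg i = g
    · simp [h1 i hi]
    · simp [hR.basis.mem_iff.1 (hj.mem_iff.1 hx) i hi]
  · refine eq_top_iff.2 fun x _ => ?_
    choose w hw using fun i => hj.exists_apply_eq_smul_basis (hj.repr_mem x i) i
    have : x = ∑ i, w i := hj.injective (by rw [map_sum]; simp only [hw, y.sum_repr])
    rw [this]
    refine sum_mem fun i _ => Submodule.mem_iSup_of_mem (deg i) (hj.mem_iff.2 ?_)
    rw [hw]
    exact Submodule.smul_mem _ _ (hR.basis.basis_mem i)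
  · intro g h x x' hx hx'
    rw [hj.mem_iff] at hx hx' ⊢
    rw [hj.map_mul]
    exact hR.mul_mem hx hx'
  · obtain ⟨p, q, hpq⟩ := hR.exists_basis_mul_ne_zero
    obtain ⟨x, hx⟩ := hj.exists_apply_eq_basis p
    obtain ⟨x', hx'⟩ := hj.exists_apply_eq_basis q
    exact ⟨x, x', fun h => hpq (by rw [← hx, ← hx', ← hj.map_mul, h, map_zero])⟩
  · refine or_iff_not_imp_left.2 fun hne => ?_
    -- A nonzero homogeneous ideal contains a nonzero homogeneous element; density makes its
    -- `E`-span all of `V`.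
    obtain ⟨g, x, hx, hxg, hx0⟩ : ∃ g, ∃ x ∈ J, x ∈ 𝒲 g ∧ x ≠ 0 := by
      by_contra! H
      refine hne ?_
      rw [hhom, iSup_eq_bot]
      exact fun g => (Submodule.eq_bot_iff _).2 fun x hx => H g x hx.1 hx.2
    have hinv : ∀ m ∈ mulAlgebra F W, ∀ x ∈ J, m x ∈ J := by
      intro m hm
      induction hm using NonUnitalAlgebra.adjoin_induction with
      | mem m hm =>
        rcases hm with ⟨a, rfl⟩ | ⟨a, rfl⟩
        exacts [fun x hx => (hJ x hx a).1, fun x hx => (hJ x hx a).2]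
      | add m m' _ _ h h' => exact fun x hx => add_mem (h x hx) (h' x hx)
      | zero => exact fun x _ => zero_mem J
      | mul m m' _ _ h h' => exact fun x hx => h _ (h' x hx)
      | smul c m _ h => exact fun x hx => Submodule.smul_mem _ c (h x hx)
    have hword {d : G} {a : End E V} (ha : HomogeneousWord (homogeneousPart 𝒱 R) d a) :
        ∀ x ∈ J, ∃ x' ∈ J, j x' = a (j x) := by
      induction ha with
      | one => exact fun x hx => ⟨x, hx, rfl⟩
      | left h =>
        intro x hx
        obtain ⟨w, hw⟩ := hj.exists_eq _ (hRK _ h.1)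
        exact ⟨w * x, (hJ x hx w).1, by rw [hj.map_mul, hw]; rfl⟩
      | right h =>
        intro x hx
        obtain ⟨w, hw⟩ := hj.exists_eq _ (hRK _ h.1)
        exact ⟨x * w, (hJ x hx w).2, by rw [hj.map_mul, hw]; rfl⟩
      | mul _ _ ih ih' =>
        intro x hx
        obtain ⟨x', hx', e⟩ := ih' x hx
        obtain ⟨x'', hx'', e'⟩ := ih x' hx'
        exact ⟨x'', hx'', by rw [e', e]; rfl⟩
    have htop : Submodule.span E (j '' J) = ⊤ := by
      rw [eq_top_iff, ← y.span_eq, Submodule.span_le]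
      rintro _ ⟨i, rfl⟩
      obtain ⟨a, ha, e⟩ := hR.exists_apply_eq (hj.mem_iff.1 hxg)
        (fun h => hx0 (hj.injective (h.trans (map_zero j).symm))) (hR.basis.basis_mem i)
      rw [← e]
      clear e
      induction ha using Submodule.span_induction with
      | zero => exact zero_mem _
      | add a b _ _ ha hb => exact add_mem ha hb
      | smul c a _ ha => exact Submodule.smul_mem _ c ha
      | mem a ha =>
        obtain ⟨x', hx', e⟩ := hword ha x hx
        exact Submodule.subset_span ⟨x', hx', e⟩
    exact eq_top_iff.2 fun w _ => hj.mem_of_mem_span hscal hinv (htop ▸ trivial)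

/-- The neutral component of the centroid is the field `K`. -/
theorem exists_apply_eq_smul_of_mem_neutralCentroid (hj : IsScalarForm 𝒱 y K 𝒲 j)
    (hR : IsDenseForm 𝒱 R y deg) [Finite I] (hRK : ∀ r ∈ R, ∀ i, y.repr r i ∈ K)
    (hscal : ∀ k ∈ K, ∃ m ∈ mulAlgebra F W, ∀ x, j (m x) = k • j x) {φ : End F W}
    (hφ : φ ∈ neutralCentroid 𝒲) : ∃ c ∈ K, ∀ x, j (φ x) = c • j x := by
  have := Fintype.ofFinite I
  choose w hw using hj.exists_apply_eq_basis
  -- The `E`-linear extension of `φ`. It agrees with `φ` on all of `W` because multiplication by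
  -- elements of `K` belongs to the multiplication algebra, with which `φ` commutes.
  let T : End E V := y.constr E fun i => j (φ (w i))
  have hTy (i : I) : T (y i) = j (φ (w i)) := Basis.constr_basis _ _ _ _
  have hT (x : W) : T (j x) = j (φ x) := by
    choose m hm e using fun i => hscal _ (hj.repr_mem x i)
    have hx : x = ∑ i, m i (w i) := hj.injective (by
      rw [map_sum]; simp only [e, hw, y.sum_repr])
    have hc (i : I) : φ (m i (w i)) = m i (φ (w i)) := congr($(hφ.1 _ (hm i)) (w i))
    conv_rhs => rw [hx]
    rw [← y.sum_repr (j x)]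
    simp only [map_sum, map_smul, hTy, hc, e]
  obtain ⟨c, hc⟩ := hR.exists_eq_smul_of_commute (T := T) (fun r hr v => by
      obtain ⟨x, rfl⟩ := hj.exists_eq r (hRK r hr)
      suffices h : T * LinearMap.mulLeft E (j x) = LinearMap.mulLeft E (j x) * T from congr($h v)
      refine y.ext fun i => ?_
      simp only [Module.End.mul_apply, LinearMap.mulLeft_apply]
      rw [← hw, ← hj.map_mul, hT, hT, neutralCentroid_mul_left hφ, hj.map_mul]) (fun r hr v => by
      obtain ⟨x, rfl⟩ := hj.exists_eq r (hRK r hr)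
      suffices h : T * LinearMap.mulRight E (j x) = LinearMap.mulRight E (j x) * T from congr($h v)
      refine y.ext fun i => ?_
      simp only [Module.End.mul_apply, LinearMap.mulRight_apply]
      rw [← hw, ← hj.map_mul, hT, hT, neutralCentroid_mul_right hφ, hj.map_mul]) (fun g v hv => by
      refine hR.basis.induction_on (p := fun v => T v ∈ 𝒱 g) hv (by simp)
        (fun x z hx hz => by rw [map_add]; exact add_mem hx hz)
        (fun c x hx => by rw [map_smul]; exact Submodule.smul_mem _ c hx) ?_
      rintro i rfl
      rw [hTy, ← hj.mem_iff]
      refine hφ.2 _ _ (hj.mem_iff.2 ?_)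
      rw [hw]
      exact hR.basis.basis_mem i)
  refine ⟨c, ?_, fun x => by rw [← hT, hc]⟩
  -- The scalar is itself a coordinate: that of `c • y p` at `p`.
  obtain ⟨p, -, -⟩ := hR.exists_basis_mul_ne_zero
  have := hj.repr_mem (φ (w p)) p
  rw [← hT, hc, hw] at this
  simpa using this

theorem exists_mem_neutralCentroid (hj : IsScalarForm 𝒱 y K 𝒲 j)
    (hscal : ∀ k ∈ K, ∃ m ∈ mulAlgebra F W, ∀ x, j (m x) = k • j x) {k : E} (hk : k ∈ K) :
    ∃ φ ∈ neutralCentroid 𝒲, ∀ x, j (φ x) = k • j x := by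
  obtain ⟨m, -, e⟩ := hscal k hk
  refine ⟨m, ⟨fun m' hm' => ?_, fun g x hx => ?_⟩, e⟩
  · obtain ⟨T, hT⟩ := hj.exists_lift hm'
    ext x
    refine hj.injective ?_
    simp only [Module.End.mul_apply]
    rw [e, hT, hT, e, map_smul]
  · rw [hj.mem_iff, e]
    exact Submodule.smul_mem _ _ (hj.mem_iff.1 hx)

end IsScalarForm

end ScalarForm

/-! ### Scalar operators as elements of `E`, and extension of scalars -/

section ScalarForm

open Module

variable {F E G V W I : Type*} [Field F] [Field E] [Algebra F E] [CommGroup G]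
  [NonUnitalNonAssocRing V] [Module E V] [Module F V] [IsScalarTower F E V]

/-- A commutative family of operators that act as scalars of `E` embeds into `E`. -/
theorem exists_scalarHom {A : Type*} [AddCommGroup A] [Module F A] (i : A →ₗ[F] V)
    (C : Subalgebra F (End F A)) (hne : ∃ a, i a ≠ 0)
    (H : ∀ s ∈ C, ∃ c : E, ∀ a, i (s a) = c • i a) :
    ∃ φ : C →ₐ[F] E, ∀ (s : C) (a : A), i (s.1 a) = φ s • i a := by
  obtain ⟨a₀, h₀⟩ := hne
  choose f hf using fun s : C => H s.1 s.2
  have huniq {c c' : E} (h : c • i a₀ = c' • i a₀) : c = c' := smul_left_injective E h₀ h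
  refine ⟨{ toFun := f
            map_one' := huniq ?_
            map_mul' := fun s t => huniq ?_
            map_zero' := huniq ?_
            map_add' := fun s t => huniq ?_
            commutes' := fun c => huniq ?_ }, hf⟩
  · rw [← hf, one_smul]; rfl
  · rw [mul_smul, ← hf t, ← hf (s * t), ← hf s]; rfl
  · rw [← hf, zero_smul]; exact map_zero i
  · rw [add_smul, ← hf, ← hf, ← hf]; exact map_add i _ _
  · rw [← hf, algebraMap_smul, ← map_smul]; rfl

variable [IsScalarTower E V V] [SMulCommClass E V V]
  [NonUnitalNonAssocRing W] [Module F W] [IsScalarTower F W W] [SMulCommClass F W W]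

namespace IsScalarForm

variable {𝒱 : G → Submodule E V} {R : NonUnitalSubalgebra F V} {y : Basis I E V} {deg : I → G}
  {K : Subfield E} {𝒲 : G → Submodule F W} {j : W →ₗ[F] V}

/-- Preimages of the `y i` form a basis of `W` over its neutral centroid, since `κ` identifies the
centroid with a field containing all coordinates; the isomorphism matches the two bases. -/
theorem exists_linearEquiv (hj : IsScalarForm 𝒱 y K 𝒲 j)
    (hb : IsHomogeneousBasis 𝒱 y deg) [Finite I] [IsMulCommutative (neutralCentroid 𝒲)]
    (κ : neutralCentroid 𝒲 →ₐ[F] E) (hκ : ∀ (φ : neutralCentroid 𝒲) x, j (φ.1 x) = κ φ • j x)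
    (hκ0 : Function.Injective κ) (hκK : ∀ k ∈ K, ∃ φ, κ φ = k) :
    letI : Algebra (neutralCentroid 𝒲) E := κ.toRingHom.toAlgebra
    ∃ Φ : E ⊗[neutralCentroid 𝒲] W ≃ₗ[E] V,
      (∀ (c : E) (x : W), Φ (c ⊗ₜ x) = c • j x) ∧
      (∀ t t' : E ⊗[neutralCentroid 𝒲] W, Φ (t * t') = Φ t * Φ t') ∧
      ∀ g : G, (Submodule.span E {t | ∃ x ∈ 𝒲 g, t = (1 : E) ⊗ₜ[neutralCentroid 𝒲] x}).map
        (Φ : _ →ₗ[E] V) = 𝒱 g := by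
  have := Fintype.ofFinite I
  let _ : Algebra (neutralCentroid 𝒲) E := κ.toRingHom.toAlgebra
  have hsmul (φ : neutralCentroid 𝒲) (x : W) : j (φ • x) = κ φ • j x := hκ φ x
  choose w hw using hj.exists_apply_eq_basis
  have hli : LinearIndependent (neutralCentroid 𝒲) w := by
    refine Fintype.linearIndependent_iff.2 fun c hc i => hκ0 ?_
    rw [map_zero]
    have h1 := congrArg j hc
    rw [map_sum, map_zero] at h1
    simp only [hsmul, hw] at h1
    exact Fintype.linearIndependent_iff.1 y.linearIndependent _ h1 i
  have hsp : ⊤ ≤ Submodule.span (neutralCentroid 𝒲) (Set.range w) := by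
    intro x _
    choose φ hφ using fun i => hκK _ (hj.repr_mem x i)
    have : x = ∑ i, φ i • w i := hj.injective (by
      rw [map_sum]; simp only [hsmul, hφ, hw, y.sum_repr])
    rw [this]
    exact sum_mem fun i _ => Submodule.smul_mem _ _ (Submodule.subset_span ⟨i, rfl⟩)
  let wb : Basis I (neutralCentroid 𝒲) W := Basis.mk hli hsp
  have hwb (i : I) : wb i = w i := by simp [wb]
  let Φ : E ⊗[neutralCentroid 𝒲] W ≃ₗ[E] V := (wb.baseChange E).equiv y (Equiv.refl I)
  have hΦb (i : I) : Φ (1 ⊗ₜ w i) = y i := by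
    have := (wb.baseChange E).equiv_apply i y (Equiv.refl I)
    rwa [Basis.baseChange_apply, hwb] at this
  have hΦ1 (x : W) : Φ (1 ⊗ₜ x) = j x := by
    rw [← wb.sum_repr x, TensorProduct.tmul_sum, map_sum, map_sum]
    refine Finset.sum_congr rfl fun i _ => ?_
    rw [hsmul, hwb, hw, ← hΦb, ← map_smul, TensorProduct.smul_tmul', ← TensorProduct.smul_tmul]
    rfl
  have hΦ (c : E) (x : W) : Φ (c ⊗ₜ x) = c • j x := by
    rw [← hΦ1, ← map_smul, TensorProduct.smul_tmul', smul_eq_mul, mul_one]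
  refine ⟨Φ, hΦ, fun t t' => ?_, fun g => le_antisymm ?_ ?_⟩
  · induction t using TensorProduct.induction_on with
    | zero => simp
    | add s s' hs hs' => rw [add_mul, map_add, hs, hs', map_add, add_mul]
    | tmul c x =>
      induction t' using TensorProduct.induction_on with
      | zero => simp
      | add s s' hs hs' => rw [mul_add, map_add, hs, hs', map_add, mul_add]
      | tmul c' x' =>
        rw [Algebra.TensorProduct.tmul_mul_tmul, hΦ, hΦ, hΦ, hj.map_mul, smul_mul_smul_comm]
  · rw [Submodule.map_le_iff_le_comap, Submodule.span_le]
    rintro _ ⟨x, hx, rfl⟩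
    change Φ (1 ⊗ₜ x) ∈ 𝒱 g
    rw [hΦ1]
    exact hj.mem_iff.1 hx
  · intro v hv
    refine hb.induction_on hv (zero_mem _) (fun _ _ => add_mem)
      (fun c x => Submodule.smul_mem _ c) ?_
    rintro i rfl
    exact ⟨1 ⊗ₜ w i, Submodule.subset_span ⟨w i, hj.mem_iff.2 (hw i ▸ hb.basis_mem i), rfl⟩, hΦb i⟩

end IsScalarForm

end ScalarForm

/-! ### The central localization as a form over the field of central scalars -/

section Localization

open Module

variable {F E G V A I : Type*} [Field F] [Field E] [Algebra F E] [CommGroup G]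
  [NonUnitalNonAssocRing V] [Module E V] [Module F V] [IsScalarTower F E V]
  [IsScalarTower E V V] [SMulCommClass E V V]
  [NonUnitalNonAssocRing A] [Module F A] [IsScalarTower F A A] [SMulCommClass F A A]

/-- `i` identifies the graded algebra `A` with the subalgebra `R` of `V`. -/
structure IsGradedEmbedding (𝒜 : G → Submodule F A) (𝒱 : G → Submodule E V)
    (R : NonUnitalSubalgebra F V) (i : A →ₙₐ[F] V) : Prop where
  injective : Function.Injective i
  apply_mem : ∀ a, i a ∈ R
  exists_eq : ∀ r ∈ R, ∃ a, i a = r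
  mem_iff : ∀ {g a}, a ∈ 𝒜 g ↔ i a ∈ 𝒱 g

namespace IsGradedEmbedding

variable {𝒜 : G → Submodule F A} {𝒱 : G → Submodule E V} {R : NonUnitalSubalgebra F V}
  {y : Basis I E V} {deg : I → G} {i : A →ₙₐ[F] V}

theorem exists_mem_subMulAlgebra (hi : IsGradedEmbedding 𝒜 𝒱 R i) {m : End F A}
    (hm : m ∈ mulAlgebra F A) : ∃ T ∈ subMulAlgebra E R, ∀ a, i (m a) = T (i a) := by
  induction hm using NonUnitalAlgebra.adjoin_induction with
  | mem m hm =>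
    rcases hm with ⟨a, rfl⟩ | ⟨a, rfl⟩
    · exact ⟨_, mulLeft_mem_subMulAlgebra (hi.apply_mem a), map_mul i a⟩
    · exact ⟨_, mulRight_mem_subMulAlgebra (hi.apply_mem a), fun x => map_mul i x a⟩
  | add m m' _ _ h h' =>
    obtain ⟨T, hT, e⟩ := h
    obtain ⟨T', hT', e'⟩ := h'
    exact ⟨T + T', add_mem hT hT', fun x => by simp [e, e']⟩
  | zero => exact ⟨0, zero_mem _, by simp⟩
  | mul m m' _ _ h h' =>
    obtain ⟨T, hT, e⟩ := h
    obtain ⟨T', hT', e'⟩ := h'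
    exact ⟨T * T', mul_mem hT hT', fun x => by simp [e, e']⟩
  | smul c m _ h =>
    obtain ⟨T, hT, e⟩ := h
    exact ⟨c • T, SMulMemClass.smul_mem c hT, fun x => by simp [e]⟩

theorem exists_mem_mulAlgebra (hi : IsGradedEmbedding 𝒜 𝒱 R i) {T : End E V}
    (hT : T ∈ subMulAlgebra E R) : ∃ m ∈ mulAlgebra F A, ∀ a, i (m a) = T (i a) := by
  induction hT using NonUnitalAlgebra.adjoin_induction with
  | mem T hT =>
    rcases hT with ⟨r, hr, rfl⟩ | ⟨r, hr, rfl⟩ <;> obtain ⟨a, rfl⟩ := hi.exists_eq r hr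
    · exact ⟨_, mulLeft_mem_mulAlgebra a, map_mul i a⟩
    · exact ⟨_, mulRight_mem_mulAlgebra a, fun x => map_mul i x a⟩
  | add m m' _ _ h h' =>
    obtain ⟨T, hT, e⟩ := h
    obtain ⟨T', hT', e'⟩ := h'
    exact ⟨T + T', add_mem hT hT', fun x => by simp [e, e']⟩
  | zero => exact ⟨0, zero_mem _, by simp⟩
  | mul m m' _ _ h h' =>
    obtain ⟨T, hT, e⟩ := h
    obtain ⟨T', hT', e'⟩ := h'
    exact ⟨T * T', mul_mem hT hT', fun x => by simp [e, e']⟩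
  | smul c m _ h =>
    obtain ⟨T, hT, e⟩ := h
    exact ⟨c • T, SMulMemClass.smul_mem c hT, fun x => by simp [e]⟩

/-- Elements of the neutral component of the centre act as scalars. -/
theorem exists_apply_eq_smul (hi : IsGradedEmbedding 𝒜 𝒱 R i) (hR : IsDenseForm 𝒱 R y deg)
    {z : End F A} (hz : z ∈ neutralCenter 𝒜) :
    ∃ c : E, c • (1 : End E V) ∈ subMulAlgebra E R ∧ ∀ a, i (z a) = c • i a := by
  obtain ⟨T, hT, e⟩ := hi.exists_mem_subMulAlgebra hz.1
  have hz' := neutralCenter_le_neutralCentroid hz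
  obtain ⟨c, hc⟩ := hR.exists_eq_smul_of_commute (T := T) (fun r hr v => by
      obtain ⟨x, rfl⟩ := hi.exists_eq r hr
      suffices h : T * LinearMap.mulLeft E (i x) = LinearMap.mulLeft E (i x) * T from congr($h v)
      refine y.ext fun l => ?_
      obtain ⟨b, hb⟩ := hi.exists_eq _ (hR.basis_mem l)
      simp only [Module.End.mul_apply, LinearMap.mulLeft_apply]
      rw [← hb, ← map_mul, ← e, ← e, neutralCentroid_mul_left hz', map_mul]) (fun r hr v => by
      obtain ⟨x, rfl⟩ := hi.exists_eq r hr
      suffices h : T * LinearMap.mulRight E (i x) = LinearMap.mulRight E (i x) * T from congr($h v)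
      refine y.ext fun l => ?_
      obtain ⟨b, hb⟩ := hi.exists_eq _ (hR.basis_mem l)
      simp only [Module.End.mul_apply, LinearMap.mulRight_apply]
      rw [← hb, ← map_mul, ← e, ← e, neutralCentroid_mul_right hz', map_mul]) (fun g v hv => by
      refine hR.basis.induction_on (p := fun v => T v ∈ 𝒱 g) hv (by simp)
        (fun x z hx hz => by rw [map_add]; exact add_mem hx hz)
        (fun c x hx => by rw [map_smul]; exact Submodule.smul_mem _ c hx) ?_
      rintro l rfl
      obtain ⟨b, hb⟩ := hi.exists_eq _ (hR.basis_mem l)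
      rw [← hb, ← e, ← hi.mem_iff]
      refine hz'.2 _ _ (hi.mem_iff.2 ?_)
      rw [hb]
      exact hR.basis.basis_mem l)
  refine ⟨c, ?_, fun a => by rw [e, hc]⟩
  convert hT
  ext v
  simp [hc]

/-- A scalar operator commutes with every operator extending to `V` and preserves degrees, so
membership in the multiplication algebra suffices. -/
theorem exists_mem_neutralCenter (hi : IsGradedEmbedding 𝒜 𝒱 R i) {c : E}
    (hc : c • (1 : End E V) ∈ subMulAlgebra E R) :
    ∃ z ∈ neutralCenter 𝒜, ∀ a, i (z a) = c • i a := by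
  obtain ⟨z, hz, e⟩ := hi.exists_mem_mulAlgebra hc
  replace e (a : A) : i (z a) = c • i a := by simpa using e a
  refine ⟨z, ⟨hz, fun m hm => ?_, fun g a ha => ?_⟩, e⟩
  · obtain ⟨T, -, hT⟩ := hi.exists_mem_subMulAlgebra hm
    ext a
    refine hi.injective ?_
    simp only [Module.End.mul_apply]
    rw [e, hT, hT, e, map_smul]
  · rw [hi.mem_iff, e]
    exact Submodule.smul_mem _ _ (hi.mem_iff.1 ha)

theorem exists_ne_zero (hi : IsGradedEmbedding 𝒜 𝒱 R i) (hR : IsDenseForm 𝒱 R y deg) :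
    ∃ a, i a ≠ 0 := by
  obtain ⟨p, -, -⟩ := hR.exists_basis_mul_ne_zero
  obtain ⟨a, ha⟩ := hi.exists_eq _ (hR.basis_mem p)
  exact ⟨a, ha ▸ y.ne_zero p⟩

theorem exists_centralScalars_hom (hi : IsGradedEmbedding 𝒜 𝒱 R i)
    (hR : IsDenseForm 𝒱 R y deg) :
    ∃ φ : centralScalars 𝒜 →ₐ[F] E, ∀ (s : centralScalars 𝒜) (a : A), i (s.1 a) = φ s • i a := by
  refine exists_scalarHom (i : A →ₗ[F] V) (centralScalars 𝒜) (hi.exists_ne_zero hR) fun s hs => ?_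
  induction hs using Algebra.adjoin_induction with
  | mem s hs =>
    obtain ⟨c, -, hc⟩ := hi.exists_apply_eq_smul hR hs
    exact ⟨c, hc⟩
  | algebraMap c => exact ⟨algebraMap F E c, fun a => by simp [Module.algebraMap_end_apply]⟩
  | add s t _ _ hs ht =>
    obtain ⟨c, hc⟩ := hs
    obtain ⟨d, hd⟩ := ht
    exact ⟨c + d, fun a => by rw [LinearMap.add_apply, map_add, hc, hd, add_smul]⟩
  | mul s t _ _ hs ht =>
    obtain ⟨c, hc⟩ := hs
    obtain ⟨d, hd⟩ := ht
    exact ⟨c * d, fun a => by rw [Module.End.mul_apply, hc, hd, smul_smul]⟩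

theorem denominators_induction {p : centralScalars 𝒜 → Prop} (one : p 1)
    (mem : ∀ s : centralScalars 𝒜, s.1 ∈ neutralCenter 𝒜 → s ≠ 0 → p s)
    (mul : ∀ s t, p s → p t → p (s * t)) {s : centralScalars 𝒜} (hs : s ∈ denominators 𝒜) :
    p s := by
  induction hs using Submonoid.closure_induction with
  | mem s hs => exact mem s hs.1 hs.2
  | one => exact one
  | mul s t _ _ hs ht => exact mul s t hs ht

/-- The embedding of the central localization into `V`. -/
theorem exists_locMap {φ : centralScalars 𝒜 →ₐ[F] E}
    (hφ : ∀ (s : centralScalars 𝒜) (a : A), i (s.1 a) = φ s • i a)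
    (hφ0 : ∀ s ∈ denominators 𝒜, φ s ≠ 0) :
    ∃ j : CentralLocalization 𝒜 →ₗ[F] V, ∀ (a : A) (s : denominators 𝒜),
      j (AlgLocalization.mk (R := centralScalars 𝒜) a s) = (φ s)⁻¹ • i a := by
  have hφ' (s : centralScalars 𝒜) (a : A) : i (s • a) = φ s • i a := hφ s a
  let f (x : CentralLocalization 𝒜) : V := LocalizedModule.liftOn x
    (fun p : A × denominators 𝒜 => (φ p.2)⁻¹ • i p.1) (by
      rintro ⟨a, s⟩ ⟨b, t⟩ ⟨u, h⟩
      have hs := hφ0 s s.2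
      have ht := hφ0 t t.2
      have hu := hφ0 u u.2
      have := congrArg i h
      simp only [Submonoid.smul_def, hφ'] at this
      have := smul_right_injective V hu this
      dsimp only
      rw [inv_smul_eq_iff₀ hs, smul_comm, eq_inv_smul_iff₀ ht]
      exact this)
  have hf (a : A) (s : denominators 𝒜) :
      f (AlgLocalization.mk (R := centralScalars 𝒜) a s) = (φ s)⁻¹ • i a := rfl
  refine ⟨{ toFun := f
            map_add' := fun x x' => ?_
            map_smul' := fun c x => ?_ }, hf⟩
  · induction x using AlgLocalization.ind with | _ a s
    induction x' using AlgLocalization.ind with | _ b t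
    have hs := hφ0 s s.2
    have ht := hφ0 t t.2
    have h1 : i (t • a) = φ t • i a := hφ' t a
    have h2 : i (s • b) = φ s • i b := hφ' s b
    rw [AlgLocalization.mk_add_mk, hf, hf, hf, map_add, h1, h2, Submonoid.coe_mul, map_mul,
      smul_add, smul_smul, smul_smul]
    congr 2 <;> field_simp
  · induction x using AlgLocalization.ind with | _ a s
    rw [AlgLocalization.smul_mk, hf, hf, map_smul, smul_comm]
    rfl

/-- The point is surjectivity onto the vectors with coordinates in `K`: such coordinates are
quotients of central scalars, hence are realised by fractions. -/
theorem isScalarForm (hi : IsGradedEmbedding 𝒜 𝒱 R i) (hR : IsDenseForm 𝒱 R y deg) [Finite I]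
    {K : Subfield E} (hRK : ∀ r ∈ R, ∀ i, y.repr r i ∈ K)
    (hK : ∀ c ∈ K, ∃ p : E, p ≠ 0 ∧ p • (1 : End E V) ∈ subMulAlgebra E R ∧
        (c * p) • (1 : End E V) ∈ subMulAlgebra E R)
    {φ : centralScalars 𝒜 →ₐ[F] E} (hφ0 : ∀ s ∈ denominators 𝒜, φ s ≠ 0 ∧ φ s ∈ K)
    (hφ : ∀ (s : centralScalars 𝒜) (a : A), i (s.1 a) = φ s • i a)
    {j : CentralLocalization 𝒜 →ₗ[F] V} (hj : ∀ (a : A) (s : denominators 𝒜),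
      j (AlgLocalization.mk (R := centralScalars 𝒜) a s) = (φ s)⁻¹ • i a) :
    IsScalarForm 𝒱 y K (locGrading 𝒜) j where
  injective := by
    refine (injective_iff_map_eq_zero j).2 fun x hx => ?_
    induction x using AlgLocalization.ind with | _ a s
    rw [hj, smul_eq_zero, inv_eq_zero, or_iff_right (hφ0 s s.2).1] at hx
    rw [hi.injective (hx.trans (map_zero i).symm), AlgLocalization.zero_mk]
  map_mul x x' := by
    induction x using AlgLocalization.ind with | _ a s
    induction x' using AlgLocalization.ind with | _ b t
    rw [AlgLocalization.mk_mul_mk, hj, hj, hj, smul_mul_smul_comm, map_mul, Submonoid.coe_mul,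
      map_mul, mul_inv]
  mem_iff {g x} := by
    constructor
    · intro hx
      induction hx using Submodule.span_induction with
      | mem x hx =>
        obtain ⟨a, ha, s, rfl⟩ := hx
        rw [hj]
        exact Submodule.smul_mem _ _ (hi.mem_iff.1 ha)
      | zero => rw [map_zero]; exact zero_mem _
      | add x x' _ _ h h' => rw [map_add]; exact add_mem h h'
      | smul c x _ h => rw [map_smul]; exact Submodule.smul_of_tower_mem _ c h
    · induction x using AlgLocalization.ind with | _ a s
      intro h
      refine Submodule.subset_span ⟨a, hi.mem_iff.2 ?_, s, rfl⟩
      rw [hj] at h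
      exact ((𝒱 g).smul_mem_iff (inv_ne_zero (hφ0 s s.2).1)).1 h
  repr_mem x l := by
    induction x using AlgLocalization.ind with | _ a s
    rw [hj, map_smul, Finsupp.smul_apply, smul_eq_mul]
    exact mul_mem (inv_mem (hφ0 s s.2).2) (hRK _ (hi.apply_mem a) l)
  exists_eq v hv := by
    have := Fintype.ofFinite I
    have key (l : I) : ∃ x, j x = y.repr v l • y l := by
      obtain ⟨p, hp, h1, h2⟩ := hK _ (hv l)
      obtain ⟨z, hz, ez⟩ := hi.exists_mem_neutralCenter h1
      obtain ⟨z', hz', ez'⟩ := hi.exists_mem_neutralCenter h2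
      obtain ⟨b, hb⟩ := hi.exists_eq _ (hR.basis_mem l)
      have hpφ : φ ⟨z, Algebra.subset_adjoin hz⟩ = p := by
        have := hφ ⟨z, Algebra.subset_adjoin hz⟩ b
        rw [ez, hb] at this
        exact (smul_left_injective E (y.ne_zero l) this).symm
      -- If `z` and `z'` act by `p` and `c * p`, with `c` the coordinate, then `z' b / z` maps to `c
      -- • y l`.
      refine ⟨AlgLocalization.mk (R := centralScalars 𝒜) (z' b) ⟨⟨z, Algebra.subset_adjoin hz⟩,
        Submonoid.subset_closure ⟨hz, fun h => hp ?_⟩⟩, ?_⟩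
      · have h0 : (⟨z, Algebra.subset_adjoin hz⟩ : centralScalars 𝒜) = 0 := h
        rw [← hpφ, h0, map_zero]
      · rw [hj, ez', hb, smul_smul]
        congr 1
        change (φ ⟨z, Algebra.subset_adjoin hz⟩)⁻¹ * _ = _
        rw [hpφ]
        field_simp
    choose x hx using key
    exact ⟨∑ l, x l, by rw [map_sum]; simp only [hx, y.sum_repr]⟩

end IsGradedEmbedding

end Localization

/-! ### The algebra of generic elements is a dense form -/

section Generic

open Module

variable {F G U E : Type*} [Field F] [NonUnitalNonAssocRing U] [Module F U]
  [IsScalarTower F U U] [SMulCommClass F U U] [Field E] [Algebra F E]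
  {𝒰 : G → Submodule F U} {n : G → ℕ} [Algebra (GenericField F n) E]

variable (F E) in
-- Specialising the variables to the identity matrix gives determinant one, and the polynomial ring
-- embeds in `E`.
theorem det_genericVar_ne_zero (n : G → ℕ) [Algebra (GenericField F n) E] (g : G) :
    (Matrix.of fun i j => genericVar F E n g i j).det ≠ 0 := by
  classical
  let P := MvPolynomial (Σ g : G, Fin (n g) × Fin (n g)) F
  let X : Matrix (Fin (n g)) (Fin (n g)) P := Matrix.of fun i j => MvPolynomial.X ⟨g, i, j⟩
  let f : P →+* E := (algebraMap (GenericField F n) E).comp (algebraMap P (GenericField F n))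
  have hf : Function.Injective f :=
    (algebraMap (GenericField F n) E).injective.comp (IsFractionRing.injective P _)
  have h1 : (Matrix.of fun i j => genericVar F E n g i j) = f.mapMatrix X := rfl
  rw [h1, ← RingHom.map_det, map_ne_zero_iff f hf]
  intro h0
  let ev : P →+* F := MvPolynomial.eval fun s => if s.2.1 = s.2.2 then 1 else 0
  have h2 : ev.mapMatrix X = 1 := by
    ext i j
    rw [Matrix.one_apply]
    exact MvPolynomial.eval_X _
  have := congrArg ev h0
  rw [RingHom.map_det, h2, Matrix.det_one, map_zero] at this
  exact one_ne_zero this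

theorem one_tmul_eq_sum_genericElement (u : ∀ g, Basis (Fin (n g)) F (𝒰 g)) (g : G)
    (j : Fin (n g)) : (1 : E) ⊗ₜ[F] (u g j : U) =
      ∑ i, (Matrix.of fun i j => genericVar F E n g i j)⁻¹ j i • genericElement E u g i := by
  set T := Matrix.of fun i j => genericVar F E n g i j with hT
  have h : T⁻¹ * T = 1 := Matrix.nonsing_inv_mul _ (det_genericVar_ne_zero F E n g).isUnit
  have h1 (i : Fin (n g)) : genericElement E u g i = ∑ l, T i l • ((1 : E) ⊗ₜ[F] (u g l : U)) := by
    simp [genericElement, hT, TensorProduct.smul_tmul']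
  simp only [h1, Finset.smul_sum, smul_smul]
  rw [Finset.sum_comm]
  simp only [← Finset.sum_smul, ← Matrix.mul_apply, h]
  simp [Matrix.one_apply]

variable [CommGroup G]

theorem IsAlgGrading.exists_homogeneousBasis (h𝒰 : IsAlgGrading 𝒰)
    (u : ∀ g, Basis (Fin (n g)) F (𝒰 g)) :
    ∃ b : Basis (Σ g, Fin (n g)) F U, (∀ s, b s = u s.1 s.2) ∧
      IsHomogeneousBasis 𝒰 b Sigma.fst := by
  classical
  have h : DirectSum.IsInternal 𝒰 :=
    (DirectSum.isInternal_submodule_iff_iSupIndep_and_iSup_eq_top _).2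
      ⟨h𝒰.independent, h𝒰.iSup_eq_top⟩
  have hb (s : Σ g, Fin (n g)) : h.collectedBasis u s = u s.1 s.2 := by simp
  refine ⟨h.collectedBasis u, hb, fun g => ?_⟩
  have h1 := congrArg (Submodule.map (𝒰 g).subtype) (u g).span_eq
  rw [Submodule.map_top, Submodule.range_subtype, Submodule.map_span, ← Set.range_comp] at h1
  rw [← h1]
  congr 1
  ext x
  constructor
  · rintro ⟨i, rfl⟩
    exact ⟨⟨g, i⟩, rfl, hb _⟩
  · rintro ⟨⟨g', i⟩, rfl, rfl⟩
    exact ⟨i, (hb _).symm⟩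

variable (E) in
theorem IsHomogeneousBasis.baseChange {I : Type*} {b : Basis I F U} {deg : I → G}
    (hb : IsHomogeneousBasis 𝒰 b deg) :
    IsHomogeneousBasis (fun g => (𝒰 g).baseChange E) (b.baseChange E) deg := by
  intro g
  dsimp only
  rw [hb g, Submodule.baseChange_span, ← Set.image_comp]
  refine congrArg _ (Set.image_congr fun i _ => ?_)
  rw [Basis.baseChange_apply]
  rfl

theorem genericElement_mem_baseChange (u : ∀ g, Basis (Fin (n g)) F (𝒰 g)) (g : G)
    (i : Fin (n g)) : genericElement E u g i ∈ (𝒰 g).baseChange E :=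
  sum_mem fun j _ => Submodule.tmul_mem_baseChange_of_mem _ (u g j).2

/-- Inverting the matrices of variables shows that the generic elements span; there are as many of
them as basis vectors, so they are independent. -/
theorem exists_genericBasis [FiniteDimensional F U] (h𝒰 : IsAlgGrading 𝒰)
    (u : ∀ g, Basis (Fin (n g)) F (𝒰 g)) :
    ∃ y : Basis (Σ g, Fin (n g)) E (E ⊗[F] U), (∀ s, y s = genericElement E u s.1 s.2) ∧
      IsHomogeneousBasis (fun g => (𝒰 g).baseChange E) y Sigma.fst := by
  classical
  obtain ⟨b, hb, hbh⟩ := h𝒰.exists_homogeneousBasis u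
  have := Module.Finite.finite_basis b
  have := Fintype.ofFinite (Σ g, Fin (n g))
  let v (s : Σ g, Fin (n g)) : E ⊗[F] U := genericElement E u s.1 s.2
  have hmem (g : G) (j : Fin (n g)) : (1 : E) ⊗ₜ[F] (u g j : U) ∈
      Submodule.span E (v '' (Sigma.fst ⁻¹' {g})) := by
    rw [one_tmul_eq_sum_genericElement]
    exact sum_mem fun i _ => Submodule.smul_mem _ _ (Submodule.subset_span ⟨⟨g, i⟩, rfl, rfl⟩)
  have htop : ⊤ ≤ Submodule.span E (Set.range v) := by
    rw [← (b.baseChange E).span_eq, Submodule.span_le]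
    rintro _ ⟨s, rfl⟩
    rw [Basis.baseChange_apply, hb]
    exact Submodule.span_mono (Set.image_subset_range _ _) (hmem s.1 s.2)
  let y := basisOfTopLeSpanOfCardEqFinrank v htop
    (Module.finrank_eq_card_basis (b.baseChange E)).symm
  have hy : ⇑y = v := coe_basisOfTopLeSpanOfCardEqFinrank _ _ _
  refine ⟨y, fun s => congrFun hy s, fun g => ?_⟩
  rw [hy]
  refine le_antisymm ?_ (Submodule.span_le.2 ?_)
  · rw [hbh.baseChange E g, Submodule.span_le]
    rintro _ ⟨s, rfl, rfl⟩
    rw [Basis.baseChange_apply, hb]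
    exact hmem s.1 s.2
  · rintro _ ⟨⟨g', i⟩, rfl, rfl⟩
    exact genericElement_mem_baseChange u g' i

variable [FiniteDimensional F U]

theorem mul_mem_baseChange (h𝒰 : IsAlgGrading 𝒰) {g h : G} {v w : E ⊗[F] U}
    (hv : v ∈ (𝒰 g).baseChange E) (hw : w ∈ (𝒰 h).baseChange E) :
    v * w ∈ (𝒰 (g * h)).baseChange E := by
  rw [Submodule.baseChange_eq_span] at hv hw
  induction hv using Submodule.span_induction with
  | zero => rw [zero_mul]; exact zero_mem _
  | add x z _ _ hx hz => rw [add_mul]; exact add_mem hx hz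
  | smul c x _ hx => rw [smul_mul_assoc]; exact Submodule.smul_mem _ c hx
  | mem v hv =>
    obtain ⟨x, hx, rfl⟩ := hv
    induction hw using Submodule.span_induction with
    | zero => rw [mul_zero]; exact zero_mem _
    | add x z _ _ hx hz => rw [mul_add]; exact add_mem hx hz
    | smul c x _ hx => rw [mul_smul_comm]; exact Submodule.smul_mem _ c hx
    | mem w hw =>
      obtain ⟨x', hx', rfl⟩ := hw
      change ((1 : E) ⊗ₜ[F] x) * ((1 : E) ⊗ₜ[F] x') ∈ _
      rw [Algebra.TensorProduct.tmul_mul_tmul]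
      exact Submodule.tmul_mem_baseChange_of_mem _ (h𝒰.mul_mem hx hx')

/-- Density for `U` is extended to `E`, and multiplications by elements of `U` are then rewritten as
`E`-combinations of multiplications by generic elements of the same degree. -/
theorem isDenseForm_genericAlgebra (hU : IsGradedSimple 𝒰) (hΓ : neutralCentroid 𝒰 = ⊥)
    (u : ∀ g, Basis (Fin (n g)) F (𝒰 g)) {y : Basis (Σ g, Fin (n g)) E (E ⊗[F] U)}
    (hy : ∀ s, y s = genericElement E u s.1 s.2)
    (hyh : IsHomogeneousBasis (fun g => (𝒰 g).baseChange E) y Sigma.fst) :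
    IsDenseForm (fun g => (𝒰 g).baseChange E) (genericAlgebra E u) y Sigma.fst := by
  classical
  obtain ⟨b, hb, hbh⟩ := hU.grading.exists_homogeneousBasis u
  have := Module.Finite.finite_basis b
  have := Fintype.ofFinite (Σ g, Fin (n g))
  have hyR (s) : y s ∈ genericAlgebra E u :=
    NonUnitalAlgebra.subset_adjoin F ⟨s.1, s.2, hy s⟩
  set H := homogeneousPart (fun g => (𝒰 g).baseChange E) (genericAlgebra E u) with hH
  have hmulw {g : G} {v : E ⊗[F] U} (hv : v ∈ (𝒰 g).baseChange E) :
      LinearMap.mulLeft E v ∈ wordSpan E H g ∧ LinearMap.mulRight E v ∈ wordSpan E H g := by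
    refine hyh.induction_on (p := fun v => LinearMap.mulLeft E v ∈ wordSpan E H g ∧
      LinearMap.mulRight E v ∈ wordSpan E H g) hv ?_ (fun x z hx hz => ?_) (fun c x hx => ?_) ?_
    · rw [LinearMap.mulLeft_zero_eq_zero, LinearMap.mulRight_zero_eq_zero]
      exact ⟨zero_mem _, zero_mem _⟩
    · have e1 : LinearMap.mulLeft E (x + z) = LinearMap.mulLeft E x + LinearMap.mulLeft E z :=
        LinearMap.ext fun v => add_mul x z v
      have e2 : LinearMap.mulRight E (x + z) = LinearMap.mulRight E x + LinearMap.mulRight E z :=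
        LinearMap.ext fun v => mul_add v x z
      rw [e1, e2]
      exact ⟨add_mem hx.1 hz.1, add_mem hx.2 hz.2⟩
    · have e1 : LinearMap.mulLeft E (c • x) = c • LinearMap.mulLeft E x :=
        LinearMap.ext fun v => smul_mul_assoc c x v
      have e2 : LinearMap.mulRight E (c • x) = c • LinearMap.mulRight E x :=
        LinearMap.ext fun v => mul_smul_comm c v x
      rw [e1, e2]
      exact ⟨Submodule.smul_mem _ c hx.1, Submodule.smul_mem _ c hx.2⟩
    · rintro s rfl
      have hs : y s ∈ H s.1 := ⟨hyR s, hyh.basis_mem s⟩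
      exact ⟨(HomogeneousWord.left hs).mem_wordSpan, (HomogeneousWord.right hs).mem_wordSpan⟩
  have hbase {d : G} {m : End F U} (hm : m ∈ wordSpan F (fun g => (𝒰 g : Set U)) d) :
      m.baseChange E ∈ wordSpan E H d := by
    induction hm using Submodule.span_induction with
    | zero => rw [LinearMap.baseChange_zero]; exact zero_mem _
    | add x z _ _ hx hz => rw [LinearMap.baseChange_add]; exact add_mem hx hz
    | smul c x _ hx =>
      rw [LinearMap.baseChange_smul]
      exact Submodule.smul_of_tower_mem _ c hx
    | mem m hm =>
      replace hm : HomogeneousWord (fun g => (𝒰 g : Set U)) d m := hm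
      induction hm with
      | one => rw [LinearMap.baseChange_one]; exact HomogeneousWord.one.mem_wordSpan
      | @left d r hr =>
        convert (hmulw (Submodule.tmul_mem_baseChange_of_mem (1 : E) hr)).1 using 1
        ext x
        simp
      | @right d r hr =>
        convert (hmulw (Submodule.tmul_mem_baseChange_of_mem (1 : E) hr)).2 using 1
        ext x
        simp
      | mul _ _ ih ih' => rw [LinearMap.baseChange_mul]; exact mul_mem_wordSpan ih ih'
  have hproj (h : G) (s : Σ g, Fin (n g)) : (1 : E) ⊗ₜ[F] homogeneousProj b Sigma.fst h (b s) =
      homogeneousProj y Sigma.fst h ((1 : E) ⊗ₜ[F] b s) := by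
    have hs : (1 : E) ⊗ₜ[F] b s ∈ (𝒰 s.1).baseChange E :=
      Submodule.tmul_mem_baseChange_of_mem _ (hbh.basis_mem s)
    by_cases h' : s.1 = h
    · subst h'
      rw [IsHomogeneousBasis.proj_basis_self, hyh.proj_apply_of_mem hs]
    · rw [IsHomogeneousBasis.proj_basis_of_ne h', hyh.proj_apply_of_mem_of_ne hs h',
        TensorProduct.tmul_zero]
  refine ⟨hyh, mul_mem_baseChange hU.grading, hyR, ?_, fun T g h => ?_⟩
  · obtain ⟨x, x', hx⟩ := hU.mul_ne_zero
    refine ⟨(1 : E) ⊗ₜ x, (1 : E) ⊗ₜ x', fun h0 => hx ?_⟩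
    rw [Algebra.TensorProduct.tmul_mul_tmul, one_mul] at h0
    refine Module.FaithfullyFlat.tensorProduct_mk_injective (A := F) (B := E) U ?_
    rw [map_zero]
    exact h0
  -- Density over `F` supplies the matrix units sending `b s` to `b l`; the entries of the matrix of
  -- `T` in the extended basis are their coefficients.
  · choose m hm e using fun s l : Σ g, Fin (n g) => exists_mem_wordSpan_eqOn hU hΓ hbh
      (b.constr F fun s' => if s' = s then b l else 0) g h
    let B := b.baseChange E
    refine ⟨∑ s, ∑ l, B.repr (T (B s)) l • (m s l).baseChange E,
      sum_mem fun s _ => sum_mem fun l _ => Submodule.smul_mem _ _ (hbase (hm s l)), fun v hv => ?_⟩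
    have hBh : IsHomogeneousBasis (fun g => (𝒰 g).baseChange E) B Sigma.fst := hbh.baseChange E
    have hB (s) : B s = (1 : E) ⊗ₜ[F] b s := Basis.baseChange_apply _ _ _
    refine hBh.induction_on (p := fun v => (∑ s, ∑ l, B.repr (T (B s)) l • (m s l).baseChange E) v
      = homogeneousProj y Sigma.fst h (T v)) hv (by simp)
      (fun x z hx hz => by simp only [map_add, hx, hz])
      (fun c x hx => by simp only [map_smul, hx]) ?_
    rintro s rfl
    conv_rhs => rw [← B.sum_repr (T (B s)), map_sum]
    rw [LinearMap.sum_apply, Finset.sum_eq_single s _ (by simp)]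
    · rw [LinearMap.sum_apply]
      refine Finset.sum_congr rfl fun l _ => ?_
      rw [LinearMap.smul_apply, map_smul]
      congr 1
      rw [hB, hB, LinearMap.baseChange_tmul, e s l _ (hbh.basis_mem s),
        Basis.constr_basis, if_pos rfl, hproj]
    · intro s' _ hs'
      rw [LinearMap.sum_apply]
      refine Finset.sum_eq_zero fun l _ => ?_
      rw [LinearMap.smul_apply, hB s, LinearMap.baseChange_tmul, e s' l _ (hbh.basis_mem s),
        Basis.constr_basis, if_neg hs'.symm, map_zero,
        TensorProduct.tmul_zero, smul_zero]

theorem isGradedEmbedding_incl (u : ∀ g, Basis (Fin (n g)) F (𝒰 g)) :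
    IsGradedEmbedding (genericGrading E u) (fun g => (𝒰 g).baseChange E) (genericAlgebra E u)
      (GenericAlg.incl E u) where
  injective := Subtype.val_injective
  apply_mem a := a.2
  exists_eq r hr := ⟨⟨r, hr⟩, rfl⟩
  mem_iff := Iff.rfl

theorem genericAlgebra_eq_adjoin (u : ∀ g, Basis (Fin (n g)) F (𝒰 g))
    {y : Basis (Σ g, Fin (n g)) E (E ⊗[F] U)} (hy : ∀ s, y s = genericElement E u s.1 s.2) :
    genericAlgebra E u = NonUnitalAlgebra.adjoin F (Set.range y) := by
  rw [genericAlgebra]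
  congr 1
  ext v
  exact ⟨fun ⟨g, i, h⟩ => ⟨⟨g, i⟩, (hy _).trans h.symm⟩, fun ⟨s, h⟩ => ⟨s.1, s.2, h ▸ hy s⟩⟩

end Generic

/-! ### Assembly -/

/-- The centre of `M(A)` acts through scalars, and the central localization is a scalar form. -/
theorem IsGradedEmbedding.exists_isScalarForm {F E G V A I : Type*} [Field F] [Field E]
    [Algebra F E] [CommGroup G]
    [NonUnitalNonAssocRing V] [Module E V] [Module F V] [IsScalarTower F E V]
    [IsScalarTower E V V] [SMulCommClass E V V]
    [IsScalarTower F V V] [SMulCommClass F V V]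
    [NonUnitalNonAssocRing A] [Module F A] [IsScalarTower F A A] [SMulCommClass F A A]
    {𝒜 : G → Submodule F A} {𝒱 : G → Submodule E V} {R : NonUnitalSubalgebra F V}
    {y : Module.Basis I E V} {deg : I → G} {i : A →ₙₐ[F] V} [Finite I]
    (hi : IsGradedEmbedding 𝒜 𝒱 R i) (hR : IsDenseForm 𝒱 R y deg)
    (hgen : R = NonUnitalAlgebra.adjoin F (Set.range y)) :
    ∃ (K : Subfield E) (ι : neutralCenter 𝒜 →ₙₐ[F] E) (j : CentralLocalization 𝒜 →ₗ[F] V),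
      (∀ c ∈ K, ∃ p : E, p ≠ 0 ∧ p • (1 : Module.End E V) ∈ subMulAlgebra E R ∧
        (c * p) • (1 : Module.End E V) ∈ subMulAlgebra E R) ∧
      (∀ c : E, c • (1 : Module.End E V) ∈ subMulAlgebra E R → c ∈ K) ∧
      (∀ r ∈ R, ∀ l, y.repr r l ∈ K) ∧
      Function.Injective ι ∧
      (∀ (z : neutralCenter 𝒜) (a : A), i (z.1 a) = ι z • i a) ∧
      (∀ z, ι z ∈ K) ∧
      (∀ c : E, c • (1 : Module.End E V) ∈ subMulAlgebra E R → ∃ z, ι z = c) ∧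
      IsScalarForm 𝒱 y K (locGrading 𝒜) j ∧
      ∀ (a : A) (s : neutralCenter 𝒜) (hs : s ≠ 0), j (centralFrac 𝒜 a s hs) = (ι s)⁻¹ • i a := by
  obtain ⟨K, hK, hK', hRK⟩ := hR.exists_scalarField hgen
  obtain ⟨φ, hφ⟩ := hi.exists_centralScalars_hom hR
  obtain ⟨a₀, ha₀⟩ := hi.exists_ne_zero hR
  have hφz (z : neutralCenter 𝒜) {c : E}
      (hc : ∀ a, i (z.1 a) = c • i a) :
      φ ⟨z.1, Algebra.subset_adjoin z.2⟩ = c :=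
    smul_left_injective E ha₀ ((hφ ⟨z.1, Algebra.subset_adjoin z.2⟩ a₀).symm.trans (hc a₀))
  have hφK (z : neutralCenter 𝒜) : φ ⟨z.1, Algebra.subset_adjoin z.2⟩ ∈ K := by
    obtain ⟨c, hc, h⟩ := hi.exists_apply_eq_smul hR z.2
    rw [hφz z h]
    exact hK' c hc
  have hφinj (z : neutralCenter 𝒜) (h : φ ⟨z.1, Algebra.subset_adjoin z.2⟩ = 0) : z = 0 := by
    refine Subtype.ext (LinearMap.ext fun a => hi.injective ?_)
    rw [hφ ⟨z.1, Algebra.subset_adjoin z.2⟩ a, h, zero_smul]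
    exact (map_zero _).symm
  have hφ0 : ∀ s ∈ denominators (𝒜), φ s ≠ 0 ∧ φ s ∈ K := by
    intro s hs
    refine IsGradedEmbedding.denominators_induction (p := fun s => φ s ≠ 0 ∧ φ s ∈ K) ?_
      (fun s hs hs0 => ?_) (fun s t hs ht => ?_) hs
    · rw [map_one]; exact ⟨one_ne_zero, one_mem K⟩
    · refine ⟨fun h => hs0 (Subtype.ext ?_), hφK ⟨s.1, hs⟩⟩
      exact (congrArg Subtype.val (hφinj ⟨s.1, hs⟩ h) :)
    · rw [map_mul]; exact ⟨mul_ne_zero hs.1 ht.1, mul_mem hs.2 ht.2⟩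
  let ι : neutralCenter 𝒜 →ₙₐ[F] E :=
    { toFun := fun z => φ ⟨z.1, Algebra.subset_adjoin z.2⟩
      map_smul' := fun c z => map_smul φ c ⟨z.1, Algebra.subset_adjoin z.2⟩
      map_zero' := map_zero φ
      map_add' := fun z z' => map_add φ ⟨z.1, Algebra.subset_adjoin z.2⟩
        ⟨z'.1, Algebra.subset_adjoin z'.2⟩
      map_mul' := fun z z' => map_mul φ ⟨z.1, Algebra.subset_adjoin z.2⟩
        ⟨z'.1, Algebra.subset_adjoin z'.2⟩ }
  have hιinj : Function.Injective ι := (injective_iff_map_eq_zero ι).2 fun z hz => hφinj z hz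
  have hι (z : neutralCenter 𝒜) (a : A) :
      i (z.1 a) = ι z • i a := hφ ⟨z.1, Algebra.subset_adjoin z.2⟩ a
  have hιsurj {c : E} (hc : c • (1 : Module.End E (V)) ∈
      subMulAlgebra E (R)) : ∃ z, ι z = c := by
    obtain ⟨z, hz, h⟩ := hi.exists_mem_neutralCenter hc
    exact ⟨⟨z, hz⟩, hφz ⟨z, hz⟩ h⟩
  obtain ⟨j, hj⟩ := IsGradedEmbedding.exists_locMap hφ fun s hs => (hφ0 s hs).1
  have hJ := hi.isScalarForm hR hRK hK hφ0 hφ hj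
  exact ⟨K, ι, j, hK, hK', hRK, hιinj, hι, hφK, fun c hc => hιsurj hc, hJ, fun a s hs => hj _ _⟩

/-- The neutral component of the centroid of a scalar form is its field of scalars. -/
theorem IsScalarForm.exists_neutralCentroid {F E G V A W I : Type*} [Field F] [Field E]
    [Algebra F E] [CommGroup G]
    [NonUnitalNonAssocRing V] [Module E V] [Module F V] [IsScalarTower F E V]
    [IsScalarTower E V V] [SMulCommClass E V V]
    [NonUnitalNonAssocRing A] [Module F A] [IsScalarTower F A A] [SMulCommClass F A A]
    [NonUnitalNonAssocRing W] [Module F W] [IsScalarTower F W W] [SMulCommClass F W W]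
    {K : Subfield E} {𝒲 : G → Submodule F W} {j : W →ₗ[F] V}
    {𝒜 : G → Submodule F A} {𝒱 : G → Submodule E V} {R : NonUnitalSubalgebra F V}
    {y : Module.Basis I E V} {deg : I → G} {i : A →ₙₐ[F] V} [Finite I]
    {ι : neutralCenter 𝒜 →ₙₐ[F] E} {frac : A → ∀ s : neutralCenter 𝒜, s ≠ 0 → W}
    (hJ : IsScalarForm 𝒱 y K 𝒲 j) (hR : IsDenseForm 𝒱 R y deg)
    (hK : ∀ c ∈ K, ∃ p : E, p ≠ 0 ∧ p • (1 : Module.End E V) ∈ subMulAlgebra E R ∧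
      (c * p) • (1 : Module.End E V) ∈ subMulAlgebra E R)
    (hK' : ∀ c : E, c • (1 : Module.End E V) ∈ subMulAlgebra E R → c ∈ K)
    (hRK : ∀ r ∈ R, ∀ l, y.repr r l ∈ K)
    (hιinj : Function.Injective ι)
    (hι : ∀ (z : neutralCenter 𝒜) (a : A), i (z.1 a) = ι z • i a)
    (hιK : ∀ z, ι z ∈ K)
    (hιsurj : ∀ c : E, c • (1 : Module.End E V) ∈ subMulAlgebra E R → ∃ z, ι z = c)
    (hjfrac : ∀ (a : A) (s : neutralCenter 𝒜) (hs : s ≠ 0), j (frac a s hs) = (ι s)⁻¹ • i a) :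
    IsGradedSimple 𝒲 ∧
      SatisfiesPI (mulAlgebra F W) ∧
      ∃ _ : IsMulCommutative (neutralCentroid 𝒲),
        IsField (neutralCentroid 𝒲) ∧
        ∃ τ : neutralCenter 𝒜 →ₙₐ[F] neutralCentroid 𝒲,
          Function.Injective τ ∧
          (∀ (z : neutralCenter 𝒜) (a : A) (s : neutralCenter 𝒜) (hs : s ≠ 0),
            (τ z).1 (frac a s hs) = frac (z.1 a) s hs) ∧
          (∀ k : neutralCentroid 𝒲, ∃ z s : neutralCenter 𝒜, s ≠ 0 ∧ τ s * k = τ z) ∧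
          ∃ (κ : neutralCentroid 𝒲 →ₐ[F] E) (j : W →ₗ[F] V),
            (∀ z : neutralCenter 𝒜, κ (τ z) = ι z) ∧
            (∀ (a : A) (s : neutralCenter 𝒜) (hs : s ≠ 0), j (frac a s hs) = (ι s)⁻¹ • i a) ∧
            letI : Algebra (neutralCentroid 𝒲) E := κ.toRingHom.toAlgebra
            ∃ Φ : E ⊗[neutralCentroid 𝒲] W ≃ₗ[E] V,
              (∀ (c : E) (x : W), Φ (c ⊗ₜ x) = c • j x) ∧
              (∀ x y : E ⊗[neutralCentroid 𝒲] W, Φ (x * y) = Φ x * Φ y) ∧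
              ∀ g : G, (Submodule.span E {y | ∃ x ∈ 𝒲 g,
                  y = (1 : E) ⊗ₜ[neutralCentroid 𝒲] x}).map
                (Φ : _ →ₗ[E] V) = 𝒱 g := by
  have hscal (k : E) (hk : k ∈ K) := hJ.exists_scalar_mem_mulAlgebra hRK hK hK' hk
  obtain ⟨x₀, hx₀⟩ : ∃ x, j x ≠ 0 := by
    obtain ⟨p, -, -⟩ := hR.exists_basis_mul_ne_zero
    obtain ⟨x, hx⟩ := hJ.exists_apply_eq_basis p
    exact ⟨x, hx ▸ y.ne_zero p⟩
  obtain ⟨κ, hκ⟩ := exists_scalarHom j (neutralCentroid 𝒲) ⟨x₀, hx₀⟩ fun ψ hψ =>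
    let ⟨c, _, h⟩ := hJ.exists_apply_eq_smul_of_mem_neutralCentroid hR hRK hscal hψ
    ⟨c, h⟩
  have hκu (ψ : neutralCentroid 𝒲) {c : E} (hc : ∀ x, j (ψ.1 x) = c • j x) : κ ψ = c :=
    smul_left_injective E hx₀ ((hκ ψ x₀).symm.trans (hc x₀))
  have hκinj : Function.Injective κ := (injective_iff_map_eq_zero κ).2 fun ψ hψ =>
    Subtype.ext (LinearMap.ext fun x => hJ.injective (by
      rw [hκ, hψ, zero_smul]; exact (map_zero j).symm))
  -- Together with `hκsurj` and `hκinj`, this identifies the neutral centroid with `K`, so it is a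
  -- field; `τ` is then defined by lifting `ι` through `κ`.
  have hκK (ψ : neutralCentroid 𝒲) : κ ψ ∈ K := by
    obtain ⟨c, hc, h⟩ := hJ.exists_apply_eq_smul_of_mem_neutralCentroid hR hRK hscal ψ.2
    rwa [hκu ψ h]
  have hκsurj (k : E) (hk : k ∈ K) : ∃ ψ, κ ψ = k := by
    obtain ⟨ψ, hψ, h⟩ := hJ.exists_mem_neutralCentroid hscal hk
    exact ⟨⟨ψ, hψ⟩, hκu ⟨ψ, hψ⟩ h⟩
  have hcomm : IsMulCommutative (neutralCentroid 𝒲) :=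
    ⟨⟨fun ψ ψ' => hκinj (by rw [_root_.map_mul, _root_.map_mul, mul_comm])⟩⟩
  choose τ hτ using fun z : neutralCenter 𝒜 => hκsurj (ι z) (hιK z)
  let τ' : neutralCenter 𝒜 →ₙₐ[F] neutralCentroid 𝒲 :=
    { toFun := τ
      map_smul' := fun c z => hκinj (by rw [hτ, map_smul, MonoidHom.id_apply, map_smul, hτ])
      map_zero' := hκinj (by rw [hτ, map_zero, map_zero])
      map_add' := fun z z' => hκinj (by rw [hτ, map_add, map_add, hτ, hτ])
      map_mul' := fun z z' => hκinj (by rw [hτ, _root_.map_mul, _root_.map_mul, hτ, hτ]) }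
  refine ⟨hJ.isGradedSimple hR hRK hscal, hJ.satisfiesPI, hcomm, ?_, τ', ?_, ?_, ?_,
    κ, j, hτ, hjfrac, hJ.exists_linearEquiv hR.basis κ hκ hκinj hκsurj⟩
  · refine ⟨⟨0, 1, fun h => ?_⟩, fun a b => hκinj ?_, fun {a} ha => ?_⟩
    · simpa using congrArg κ h
    · rw [_root_.map_mul, _root_.map_mul, mul_comm]
    · obtain ⟨b, hb⟩ := hκsurj _ (inv_mem (hκK a))
      refine ⟨b, hκinj ?_⟩
      rw [_root_.map_mul, hb, map_one]
      exact mul_inv_cancel₀ fun h => ha (hκinj (h.trans (map_zero κ).symm))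
  · intro z z' h
    refine hιinj ?_
    rw [← hτ, ← hτ]
    exact congrArg κ h
  · intro z a s hs
    refine hJ.injective ?_
    rw [hκ, hjfrac, hjfrac, hι, smul_comm]
    exact congrArg (fun c => (ι s)⁻¹ • c • i a) (hτ z)
  · intro k
    -- Both `p` and `κ k * p` are scalars in the multiplication algebra of `R`, hence values of `ι`,
    -- which gives `k` as a quotient of central elements.
    obtain ⟨p, hp, h1, h2⟩ := hK _ (hκK k)
    obtain ⟨s, hs⟩ := hιsurj _ h1
    obtain ⟨z, hz⟩ := hιsurj _ h2
    refine ⟨z, s, fun h => hp ?_, hκinj ?_⟩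
    · rw [← hs, h, map_zero]
    · rw [_root_.map_mul]
      change κ (τ s) * κ k = κ (τ z)
      rw [hτ, hτ, hs, hz, mul_comm]

set_option maxHeartbeats 2000000 in
theorem mainTheorem5 {G F U E : Type*} [CommGroup G] [Field F]
    [NonUnitalNonAssocRing U] [Module F U] [IsScalarTower F U U] [SMulCommClass F U U]
    [FiniteDimensional F U]
    (𝒰 : G → Submodule F U) (hU : IsGradedSimple 𝒰) (hΓ : neutralCentroid 𝒰 = ⊥)
    (n : G → ℕ) (u : ∀ g, Module.Basis (Fin (n g)) F (𝒰 g))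
    [Field E] [Algebra F E] [Algebra (GenericField F n) E]
    [IsScalarTower F (GenericField F n) E] :
    -- (i) `Z_U` embeds in `E`: its elements act on `F_U` through scalars of `E`
    ∃ ι : genericCenter E u →ₙₐ[F] E,
      Function.Injective ι ∧
      (∀ (z : genericCenter E u) (y : GenericAlg E u),
        GenericAlg.incl E u (z.1 y) = ι z • GenericAlg.incl E u y) ∧
      -- (ii) `S⁻¹F_U` is graded simple and its multiplication algebra is PI
      IsGradedSimple (genericLocGrading E u) ∧
      SatisfiesPI (mulAlgebra F (GenericLoc E u)) ∧
      -- (iii) `K_U` is a field, namely the field of fractions of `Z_U`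
      ∃ _ : IsMulCommutative (genericCentroid E u),
        IsField (genericCentroid E u) ∧
        ∃ τ : genericCenter E u →ₙₐ[F] genericCentroid E u,
          Function.Injective τ ∧
          (∀ (z : genericCenter E u) (a : GenericAlg E u) (s : genericCenter E u)
            (hs : s ≠ 0),
            (τ z).1 (centralFrac (genericGrading E u) a s hs) =
              centralFrac (genericGrading E u) (z.1 a) s hs) ∧
          (∀ k : genericCentroid E u, ∃ z s : genericCenter E u, s ≠ 0 ∧ τ s * k = τ z) ∧
          -- (iv) the induced embeddings `K_U → E` and `S⁻¹F_U → E ⊗ U`, and the isomorphism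
          ∃ (κ : genericCentroid E u →ₐ[F] E) (j : GenericLoc E u →ₗ[F] E ⊗[F] U),
            (∀ z : genericCenter E u, κ (τ z) = ι z) ∧
            (∀ (a : GenericAlg E u) (s : genericCenter E u) (hs : s ≠ 0),
              j (centralFrac (genericGrading E u) a s hs) = (ι s)⁻¹ • GenericAlg.incl E u a) ∧
            letI : Algebra (genericCentroid E u) E := κ.toRingHom.toAlgebra
            ∃ Φ : E ⊗[genericCentroid E u] GenericLoc E u ≃ₗ[E] E ⊗[F] U,
              (∀ (c : E) (x : GenericLoc E u), Φ (c ⊗ₜ x) = c • j x) ∧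
              (∀ x y : E ⊗[genericCentroid E u] GenericLoc E u, Φ (x * y) = Φ x * Φ y) ∧
              ∀ g : G, (Submodule.span E {y | ∃ x ∈ genericLocGrading E u g,
                  y = (1 : E) ⊗ₜ[genericCentroid E u] x}).map
                (Φ : _ →ₗ[E] E ⊗[F] U) = (𝒰 g).baseChange E := by
  refine Exists.elim (exists_genericBasis (E := E) hU.grading u) fun y hy => ?_
  have := Module.Finite.finite_basis y
  have hR := isDenseForm_genericAlgebra hU hΓ u hy.1 hy.2
  refine Exists.elim ((isGradedEmbedding_incl u).exists_isScalarForm hR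
    (genericAlgebra_eq_adjoin u hy.1)) fun K h => ?_
  refine h.elim fun ι h => h.elim fun j ⟨hK, hK', hRK, hιinj, hι, hιK, hιsurj, hJ, hj⟩ =>
    ⟨ι, hιinj, hι, ?_⟩
  have key := hJ.exists_neutralCentroid hR hK hK' hRK hιinj hι hιK hιsurj hj
  refine ⟨key.1, key.2.1, key.2.2.elim fun hcomm h => ⟨hcomm, h.1, h.2.elim fun τ h =>
    ⟨τ, h.1, h.2.1, h.2.2.1, h.2.2.2.elim fun κ h => h.elim fun j h => ⟨κ, j, h.1, h.2.1, ?_⟩⟩⟩⟩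
  exact h.2.2.elim fun Φ h => ⟨Φ, h.1, h.2.1, h.2.2⟩

end
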